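/- **Theorem.** Let $m,n$ be integers with $2\le m\le n$, let $\mathbb K$ be a field of characteristic zero, and let $\mathcal H$ be a unital $(m,n)$-magmatic bialgebra over $\mathbb K$. The following are equivalent: (i) $\mathcal H$ is connected; (ii) $\mathcal H$ is isomorphic, as a unital $(m,n)$-magmatic bialgebra, to $U_{\mathrm{Mag}^{m\subset n}}(\operatorname{Prim}\mathcal H)$; (iii) $\mathcal H$ is cofree among the connected unital $m$-magmatic coalgebras. *Definitions.* A *unital $n$-magmatic algebra* is a vector space $A$ with an element $1$ and $k$-ary multilinear operations $\mu_k$ ($2\le k\le n$) such that $\mu_k(x_1,\dots,x_k)=\mu_{k-1}(x_1,\dots,x_{i-1},x_{i+1},\dots,x_k)$ whenever $x_i=1$ (with $\mu_1=\mathrm{Id}$). A *unital $m$-magmatic coalgebra* is a vector space $C=\mathbb K1\oplus\overline C$, $\overline C=\ker\varepsilon$, $\varepsilon(1)=1$, with linear maps $\Delta_k:C\to C^{\otimes k}$ ($2\le k\le m$) such that $(\mathrm{Id}^{\otimes i}\otimes\varepsilon\otimes\mathrm{Id}^{\otimes (k-1-i)})\Delta_k=\Delta_{k-1}$ for $0\le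 i\le k-1$ (with $\Delta_1=\mathrm{Id}$) and $\Delta_k(1)=1^{\otimes k}$. Morphisms are the linear maps that preserve $1$, $\varepsilon$ and all $\Delta_k$. A *unital $(m,n)$-magmatic bialgebra* is a vector space $\mathcal H=\mathbb K1\oplus\overline{\mathcal H}$ with both structures, for the same unit $1$, such that for $2\le k\le m$, $2\le l\le n$, $x_1,\dots,x_l\in\overline{\mathcal H}$ and $\underline x=\mu_l(x_1,\dots,x_l)$, $$\Delta_k(\underline x)=\sum_{i=0}^{k-1}1^{\otimes i}\otimes\underline x\otimes1^{\otimes(k-i-1)}+\sum_{i_1+\cdots+i_{l+1}=k-l}1^{\otimes i_1}\otimes x_1\otimes1^{\otimes i_2}\otimes\cdots\otimes x_l\otimes1^{\otimes i_{l+1}},$$ where the second sum is empty for $k<l$ (and is $x_1\otimes\cdots\otimes x_l$ for $k=l$). An isomorphism is a linear bijection that preserves $1$, $\varepsilon$, the $\mu_l$ and the $\Delta_k$. The *reduced co-operations* of a unital $m$-magmatic coalgebra $C$ are $\delta_1=\mathrm{Id}$ and $\delta_k(x)=\Delta_k(x)-\sum_{1\le l\le k-1}\sum_{\sigma\in \mathrm{Sh}(l,k-l)}\sigma(\delta_l(x)\otimes1^{\otimes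 (k-l)})$ for $2\le k\le m$, where $\mathrm{Sh}(l,k-l)$ is the set of $(l,k-l)$-shuffles. One puts $\operatorname{Prim}C=\bigcap_{2\le k\le m}\ker\delta_k$. For $r\ge0$ let $F_rC=\mathbb K1\oplus\{x\in\overline C:\delta(x)=0$ for every composite $\delta$ of the maps $\delta_2,\dots,\delta_m$ (applied successively to tensor factors; the empty composite $\mathrm{Id}$ being included) that has more than $r$ outputs$\}$. $C$ is *connected* if $C=\bigcup_rF_rC$. A bialgebra is connected if it is connected as a coalgebra. $C$ is *cofree among the connected unital $m$-magmatic coalgebras* if $C$ is connected and there are a vector space $V$ and a linear map $p:C\to V$ with $p(1)=0$ such that for every connected unital $m$-magmatic coalgebra $C'$ and every linear map $\varphi:C'\to V$ with $\varphi(1)=0$ there is a unique morphism of coalgebras $\tilde\varphi:C'\to C$ with $p\tilde\varphi=\varphi$. $\mathrm{Mag}^{m\subset n}$ is the non-symmetric operad which has as a basis the trivial tree and the planar rooted trees all of whose inner vertices have arity in $\{2,\dots,n\}$ and whose root has arity in $\{m+1,\dots,n\}$; composition is the plugging of trees onto leaves. $\operatorname{Prim}\mathcal H$ is a $\mathrm{Mag}^{m\subset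 n}$-algebra, a tree acting as the corresponding composite of the operations $\mu_l$. For a $\mathrm{Mag}^{m\subset n}$-algebra $A$, $U_{\mathrm{Mag}^{m\subset n}}(A)$ is the quotient of the free unital $n$-magmatic algebra on the vector space $A$ (the span of the empty tree $1$ and of the planar trees with inner arities in $\{2,\dots,n\}$ and leaves labelled by $A$) by the ideal generated by the relations $t(a_1,\dots,a_r)=\tilde t(a_1,\dots,a_r)$, where $t$ runs over the basis of the operad $\mathrm{Mag}^{m\subset n}$, $a_i\in A$, the left side is the labelled tree and the right side, an element of $A$, is the result of the action of $t$ on $A$. Its co-operations $\Delta_k$, $2\le k\le m$, are those induced by the ungrafting of trees, i.e. the unique ones that make it a unital $(m,n)$-magmatic bialgebra in which the elements of $A$ are primitive. -/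

import Mathlib

open scoped TensorProduct DirectSum

universe u v

namespace Magmatic

noncomputable section

/-! ### Planar trees -/

/-- Planar (rooted) trees all of whose inner vertices have an arity belonging to `S`. They are the
planar reduced trees as soon as `S` consists of integers `≥ 2`. -/
inductive PTree (S : Set ℕ) : Type
  | leaf : PTree S
  | node (k : ℕ) (hk : k ∈ S) (ts : Fin k → PTree S) : PTree S

namespace PTree

variable {S : Set ℕ}

/-- The type of leaves of a planar tree. -/
def Leaves : PTree S → Type
  | leaf => Unit
  | node k _ ts => Σ i : Fin k, (ts i).Leaves

/-- The number of leaves (the degree) of a planar tree. -/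
def numLeaves : PTree S → ℕ
  | leaf => 1
  | node k _ ts => ∑ i : Fin k, (ts i).numLeaves

/-- Plugging the trees `s l` onto the leaves `l` of `t`: the composition of the non-symmetric
operad of planar trees. -/
def plug : (t : PTree S) → (t.Leaves → PTree S) → PTree S
  | leaf, s => s ()
  | node k hk ts, s => node k hk fun i => (ts i).plug fun l => s ⟨i, l⟩

/-- The leaf of `t.plug s` given by a leaf `l` of `t` and a leaf of `s l`. -/
def plugLeaf : (t : PTree S) → (s : t.Leaves → PTree S) → (l : t.Leaves) → (s l).Leaves →
    (t.plug s).Leaves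
  | leaf, _, _, l' => l'
  | node _ _ ts, s, l, l' =>
    ⟨l.1, (ts l.1).plugLeaf (fun a => s ⟨l.1, a⟩) l.2 l'⟩

/-- The trees that are a basis of the operad `Mag^{T ⊂ S}`: the trivial tree (the identity
operation) and the trees in which the arity of the root does not belong to `T`. -/
def RootNotIn (T : Set ℕ) : PTree S → Prop
  | leaf => True
  | node k _ _ => k ∉ T

end PTree

/-! ### Tensor and multilinear preliminaries -/

section Prelim

variable (K : Type v) [Field K] (A : Type u) [AddCommGroup A] [Module K A]

/-- `L 0 ⊕ (L 1 ⊕ ⋯ ⊕ L k)` is `L 0 ⊕ L 1 ⊕ ⋯ ⊕ L k`. -/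
def sumSigmaEquiv {k : ℕ} (L : Fin (k + 1) → Type) :
    (L 0 ⊕ Σ i : Fin k, L i.succ) ≃ Σ i, L i where
  toFun := Sum.elim (fun l => ⟨0, l⟩) (fun p => ⟨p.1.succ, p.2⟩)
  invFun p := Fin.cases (motive := fun i => L i → L 0 ⊕ Σ i : Fin k, L i.succ)
    (fun l => Sum.inl l) (fun i l => Sum.inr ⟨i, l⟩) p.1 p.2
  left_inv := by rintro (l | ⟨i, l⟩) <;> rfl
  right_inv := by
    rintro ⟨i, l⟩
    induction i using Fin.cases <;> rfl

/-- Concatenation of tensors, `(⨂_l v_{i,l})_i ↦ ⨂_{(i,l)} v_{i,l}`, as a multilinear map; this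
formula is `concat_tprod`. -/
def concat : {k : ℕ} → (L : Fin k → Type) →
    MultilinearMap K (fun i => ⨂[K] _ : L i, A) (⨂[K] _ : (Σ i, L i), A)
  | 0, _ => MultilinearMap.constOfIsEmpty K _ (PiTensorProduct.tprod K fun p => p.1.elim0)
  | k + 1, L =>
    LinearMap.uncurryLeft
      { toFun := fun x =>
          ((PiTensorProduct.reindex K (fun _ => A) (sumSigmaEquiv L)).toLinearMap ∘ₗ
            (PiTensorProduct.tmulEquiv K A).toLinearMap ∘ₗ
            TensorProduct.mk K _ _ x).compMultilinearMap (concat fun i => L i.succ)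
        map_add' := fun x y => by ext; simp
        map_smul' := fun c x => by ext; simp }

variable {A}

theorem concat_tprod {k : ℕ} (L : Fin k → Type) (v : (Σ i, L i) → A) :
    concat K A L (fun i => PiTensorProduct.tprod K fun l => v ⟨i, l⟩) =
      PiTensorProduct.tprod K v := by
  induction k with
  | zero =>
    simp only [concat, MultilinearMap.constOfIsEmpty_apply, Function.const_apply]
    congr 1
    funext p
    exact p.1.elim0
  | succ k ih =>
    have h := ih (fun i => L i.succ) (fun p => v ⟨p.1.succ, p.2⟩)
    simp only [concat, LinearMap.uncurryLeft_apply, LinearMap.coe_mk, AddHom.coe_mk,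
      LinearMap.compMultilinearMap_apply]
    have h' : (Fin.tail fun i => PiTensorProduct.tprod K fun l => v ⟨i, l⟩) =
        fun i : Fin k => PiTensorProduct.tprod K fun l => v ⟨i.succ, l⟩ := rfl
    rw [h', h]
    simp only [LinearMap.coe_comp, Function.comp_apply, TensorProduct.mk_apply,
      LinearEquiv.coe_coe, PiTensorProduct.tmulEquiv_apply]
    refine (PiTensorProduct.reindex_tprod (s := fun _ => A) (sumSigmaEquiv L) _).trans ?_
    congr 1
    funext ⟨i, l⟩
    induction i using Fin.cases <;> rfl

/-- Concatenation of tensors indexed by the leaves of `k` trees into a tensor indexed by the leaves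
of their grafting. -/
def treeConcat {S : Set ℕ} {k : ℕ} (hk : k ∈ S) (ts : Fin k → PTree S) :
    MultilinearMap K (fun i => ⨂[K] _ : (ts i).Leaves, A)
      (⨂[K] _ : (PTree.node k hk ts).Leaves, A) :=
  concat K A fun i => (ts i).Leaves

theorem treeConcat_tprod {S : Set ℕ} {k : ℕ} (hk : k ∈ S) (ts : Fin k → PTree S)
    (v : (i : Fin k) → (ts i).Leaves → A) :
    treeConcat K hk ts (fun i => PiTensorProduct.tprod K (v i)) =
      PiTensorProduct.tprod K fun p : (PTree.node k hk ts).Leaves => v p.1 p.2 :=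
  concat_tprod K (fun i => (ts i).Leaves) fun p => v p.1 p.2

theorem extend_update {α β : Type*} {γ : Type*} [DecidableEq α] [DecidableEq β] {f : α → β}
    (hf : Function.Injective f) (v : α → γ) (w : β → γ) (a : α) (x : γ) :
    Function.extend f (Function.update v a x) w =
      Function.update (Function.extend f v w) (f a) x := by
  funext b
  by_cases hb : ∃ c, f c = b
  · obtain ⟨c, rfl⟩ := hb
    rw [hf.extend_apply]
    by_cases hc : c = a
    · subst hc; simp
    · rw [Function.update_of_ne hc, Function.update_of_ne (fun h => hc (hf h)), hf.extend_apply]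
  · rw [Function.extend_apply' _ _ _ hb, Function.update_of_ne, Function.extend_apply' _ _ _ hb]
    rintro rfl
    exact hb ⟨a, rfl⟩

/-- The linear map `A^{⊗ j} → A^{⊗ k}` inserting the vector `o` in all positions that do not belong
to the image of the increasing map `e`. Increasing maps `e : {1..j} → {1..k}` correspond to
`(j, k - j)`-shuffles, and `ins o e w` is the shuffle of `w` and `o^{⊗ (k - j)}`. -/
def ins (o : A) {j k : ℕ} (e : Fin j ↪o Fin k) :
    (⨂[K] _ : Fin j, A) →ₗ[K] (⨂[K] _ : Fin k, A) :=
  PiTensorProduct.lift <| MultilinearMap.mk'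
    (fun v => PiTensorProduct.tprod K (Function.extend e v fun _ => o))
    (fun v a x y => by simp [extend_update e.injective])
    (fun v a c x => by simp [extend_update e.injective])

theorem ins_tprod (o : A) {j k : ℕ} (e : Fin j ↪o Fin k) (v : Fin j → A) :
    ins K o e (PiTensorProduct.tprod K v) =
      PiTensorProduct.tprod K (Function.extend e v fun _ => o) := by
  simp [ins]

variable {K}

theorem update_succAbove {γ : Type*} {k : ℕ} (i : Fin (k + 1)) (v : Fin (k + 1) → γ) (a : Fin k)
    (x : γ) : (fun b => Function.update v (i.succAbove a) x (i.succAbove b)) =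
      Function.update (fun b => v (i.succAbove b)) a x :=
  Function.update_comp_eq_of_injective v (Fin.succAbove_right_injective (p := i)) a x

/-- The linear map `Id^{⊗ i} ⊗ ε ⊗ Id^{⊗ (k - i)} : A^{⊗ (k + 1)} → A^{⊗ k}`. -/
def contract (ε : A →ₗ[K] K) {k : ℕ} (i : Fin (k + 1)) :
    (⨂[K] _ : Fin (k + 1), A) →ₗ[K] (⨂[K] _ : Fin k, A) :=
  PiTensorProduct.lift <| MultilinearMap.mk'
    (fun v => ε (v i) • PiTensorProduct.tprod K fun a => v (i.succAbove a))
    (fun v a x y => by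
      induction a using i.succAboveCases with
      | x => simp [Fin.succAbove_ne, add_smul]
      | p a => simp [update_succAbove, (Fin.succAbove_ne i a).symm])
    (fun v a c x => by
      induction a using i.succAboveCases with
      | x => simp [Fin.succAbove_ne, mul_smul]
      | p a => simp [update_succAbove, (Fin.succAbove_ne i a).symm, smul_comm c])

theorem contract_tprod (ε : A →ₗ[K] K) {k : ℕ} (i : Fin (k + 1)) (v : Fin (k + 1) → A) :
    contract ε i (PiTensorProduct.tprod K v) =
      ε (v i) • PiTensorProduct.tprod K fun a => v (i.succAbove a) := by
  simp [contract]

end Prelim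

/-! ### Unital magmatic algebras, coalgebras and bialgebras -/

/-- A unital `n`-magmatic algebra: operations `mu k` of arity `2 ≤ k ≤ n` which are unitary, with
the convention `mu 1 = Id`. (The values `mu k` for `k = 0` and `k > n` play no role.) -/
structure UnitalMagAlgebra (K : Type v) [Field K] (n : ℕ) (A : Type u) [AddCommGroup A]
    [Module K A] where
  one : A
  mu : (k : ℕ) → MultilinearMap K (fun _ : Fin k => A) A
  mu_one : ∀ x : Fin 1 → A, mu 1 x = x 0
  mu_unit : ∀ k, 1 ≤ k → k + 1 ≤ n → ∀ (i : Fin (k + 1)) (x : Fin k → A),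
    mu (k + 1) (Fin.insertNth (α := fun _ => A) i one x) = mu k x

/-- A unital `m`-magmatic coalgebra `C = K 1 ⊕ ker ε`: co-operations `comul k` of arity
`2 ≤ k ≤ m` which are co-unitary and satisfy `comul k 1 = 1^{⊗ k}`, with the convention
`comul 1 = Id`. (The values `comul k` for `k = 0` and `k > m` play no role.) -/
structure UnitalMagCoalgebra (K : Type v) [Field K] (m : ℕ) (C : Type u) [AddCommGroup C]
    [Module K C] where
  one : C
  counit : C →ₗ[K] K
  counit_unit : counit one = 1
  comul : (k : ℕ) → C →ₗ[K] ⨂[K] _ : Fin k, C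
  comul_one : ∀ x : C, comul 1 x = PiTensorProduct.tprod K fun _ => x
  comul_unit : ∀ k, 2 ≤ k → k ≤ m → comul k one = PiTensorProduct.tprod K fun _ => one
  comul_counit : ∀ k, 1 ≤ k → k + 1 ≤ m → ∀ (i : Fin (k + 1)) (x : C),
    contract counit i (comul (k + 1) x) = comul k x

/-- A unital `(m,n)`-magmatic bialgebra. In the compatibility relation, the first sum is
`∑_i 1^{⊗ i} ⊗ μ_l(x_1, …, x_l) ⊗ 1^{⊗ (k - i - 1)}`; the second one is the sum of
`1^{⊗ i_1} ⊗ x_1 ⊗ 1^{⊗ i_2} ⊗ ⋯ ⊗ x_l ⊗ 1^{⊗ i_{l+1}}` over `i_1 + ⋯ + i_{l+1} = k - l`: it is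
empty for `k < l` and it is `x_1 ⊗ ⋯ ⊗ x_l` for `k = l`. -/
structure UnitalMagBialgebra (K : Type v) [Field K] (m n : ℕ) (H : Type u) [AddCommGroup H]
    [Module K H] extends UnitalMagAlgebra K n H, UnitalMagCoalgebra K m H where
  compat : ∀ k, 2 ≤ k → k ≤ m → ∀ l, 2 ≤ l → l ≤ n → ∀ x : Fin l → H, (∀ i, counit (x i) = 0) →
    comul k (mu l x) =
      ∑ i : Fin k, PiTensorProduct.tprod K (Function.update (fun _ => one) i (mu l x)) +
      ∑ e : Fin l ↪o Fin k, PiTensorProduct.tprod K (Function.extend e x fun _ => one)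

namespace UnitalMagCoalgebra

variable {K : Type v} [Field K] {m : ℕ} {C : Type u} [AddCommGroup C] [Module K C]

/-- The reduced co-operations: `δ_1 = Id` and
`δ_k(x) = Δ_k(x) - ∑_{1 ≤ l ≤ k-1} ∑_{σ ∈ Sh(l,k-l)} σ(δ_l(x), 1^{⊗ (k-l)})`. -/
def reduced (D : UnitalMagCoalgebra K m C) : (k : ℕ) → C →ₗ[K] ⨂[K] _ : Fin k, C
  | 0 => 0
  | k + 1 => D.comul (k + 1) -
      ∑ l : Fin (k + 1), ∑ e : Fin l ↪o Fin (k + 1), ins K D.one e ∘ₗ D.reduced l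

/-- The composite of reduced co-operations along a tree with inner arities `2, …, m`:
`δ_t = (δ_{t_1} ⊗ ⋯ ⊗ δ_{t_k}) ∘ δ_k` for the grafting `t` of `t_1, …, t_k`, and `Id` for the
trivial tree. -/
def reducedTree (D : UnitalMagCoalgebra K m C) :
    (t : PTree (Set.Icc 2 m)) → C →ₗ[K] ⨂[K] _ : t.Leaves, C
  | .leaf => (PiTensorProduct.subsingletonEquiv (R := K) (s := fun _ : Unit => C) ()).symm.toLinearMap
  | .node k hk ts =>
    PiTensorProduct.lift ((treeConcat K hk ts).compLinearMap
      fun i => D.reducedTree (ts i)) ∘ₗ D.reduced k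

/-- The primitive elements: the common kernel of the reduced co-operations. -/
def prim (D : UnitalMagCoalgebra K m C) : Submodule K C :=
  ⨅ k ∈ Set.Icc 2 m, LinearMap.ker (D.reduced k)

/-- The filtration: `F_r C` consists of the sums of a scalar multiple of `1` and of an element of
`ker ε` annihilated by all composites of reduced co-operations having more than `r` outputs. -/
def filtration (D : UnitalMagCoalgebra K m C) (r : ℕ) : Submodule K C :=
  Submodule.span K {D.one} ⊔
    (LinearMap.ker D.counit ⊓
      ⨅ (t : PTree (Set.Icc 2 m)) (_ : r < t.numLeaves), LinearMap.ker (D.reducedTree t))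

/-- `C` is connected (conilpotent): it is the union of its filtration. -/
def IsConnected (D : UnitalMagCoalgebra K m C) : Prop :=
  ∀ x : C, ∃ r : ℕ, x ∈ D.filtration r

/-- Morphisms of unital `m`-magmatic coalgebras. -/
structure IsHom {C' : Type*} [AddCommGroup C'] [Module K C'] (D : UnitalMagCoalgebra K m C)
    (D' : UnitalMagCoalgebra K m C') (f : C →ₗ[K] C') : Prop where
  map_unit : f D.one = D'.one
  map_counit : ∀ x, D'.counit (f x) = D.counit x
  map_comul : ∀ k, 2 ≤ k → k ≤ m → ∀ x,
    D'.comul k (f x) = PiTensorProduct.map (fun _ => f) (D.comul k x)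

/-- `C` is cofree among the connected unital `m`-magmatic coalgebras: it is connected, and there are
a vector space `V` and a linear map `p : C → V` with `p 1 = 0` such that every linear map
`φ : C' → V` with `φ 1 = 0` from a connected unital `m`-magmatic coalgebra `C'` lifts to
a unique coalgebra morphism `C' → C`. -/
def IsCofreeAmongConnected (D : UnitalMagCoalgebra K m C) : Prop :=
  D.IsConnected ∧
  ∃ (V : Type u) (_ : AddCommGroup V) (_ : Module K V) (p : C →ₗ[K] V), p D.one = 0 ∧
    ∀ (C' : Type u) [AddCommGroup C'] [Module K C'] (D' : UnitalMagCoalgebra K m C'),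
      D'.IsConnected → ∀ φ : C' →ₗ[K] V, φ D'.one = 0 →
        ∃! f : C' →ₗ[K] C, D'.IsHom D f ∧ p ∘ₗ f = φ

end UnitalMagCoalgebra

/-! ### Algebras over the operad `Mag^{T ⊂ S}` and the primitive part -/

/-- The operation associated with a planar tree, i.e. the corresponding composite of the operations
`mu k`. -/
def treeOp {K : Type v} [Field K] {A : Type u} [AddCommGroup A] [Module K A] {S : Set ℕ}
    (mu : (k : ℕ) → MultilinearMap K (fun _ : Fin k => A) A) :
    (t : PTree S) → MultilinearMap K (fun _ : t.Leaves => A) A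
  | .leaf => MultilinearMap.ofSubsingleton K A A (ι := Unit) () LinearMap.id
  | .node k _ ts => (mu k).compMultilinearMap fun i => treeOp mu (ts i)

theorem treeOp_plug {K : Type v} [Field K] {A : Type u} [AddCommGroup A] [Module K A] {S : Set ℕ}
    (mu : (k : ℕ) → MultilinearMap K (fun _ : Fin k => A) A) (t : PTree S)
    (s : t.Leaves → PTree S) (v : (t.plug s).Leaves → A) :
    treeOp mu (t.plug s) v =
      treeOp mu t fun l => treeOp mu (s l) fun l' => v (t.plugLeaf s l l') := by
  induction t with
  | leaf => rfl
  | node k hk ts ih =>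
    simp only [PTree.plug, treeOp]
    exact congrArg (mu k) (funext fun i =>
      ih i (fun a => s ⟨i, a⟩) (fun l => v ⟨i, l⟩))

/-- An algebra over the non-symmetric operad `Mag^{T ⊂ S}`. This operad has in arity `1` the identity
only, and it has as a basis in arity `r ≥ 2` the planar trees with `r` leaves and inner arities
in `S` whose root has an arity in `S \ T`; the operadic composition is plugging. -/
structure MagRootAlgebra (K : Type v) [Field K] (T S : Set ℕ) (A : Type u) [AddCommGroup A]
    [Module K A] where
  op : (t : PTree S) → t.RootNotIn T → MultilinearMap K (fun _ : t.Leaves => A) A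
  op_leaf : ∀ (h : (PTree.leaf : PTree S).RootNotIn T) (v : (PTree.leaf : PTree S).Leaves → A),
    op .leaf h v = v ()
  op_plug : ∀ (t : PTree S) (ht : t.RootNotIn T) (s : t.Leaves → PTree S)
    (hs : ∀ l, (s l).RootNotIn T) (h : (t.plug s).RootNotIn T) (v : (t.plug s).Leaves → A),
    op (t.plug s) h v = op t ht fun l => op (s l) (hs l) fun l' => v (t.plugLeaf s l l')

namespace UnitalMagBialgebra

variable {K : Type v} [Field K] {m n : ℕ} {H : Type u} [AddCommGroup H] [Module K H]

theorem reduced_one (D : UnitalMagCoalgebra K m H) (x : H) :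
    D.reduced 1 x = PiTensorProduct.tprod K fun _ => x := by
  simp [UnitalMagCoalgebra.reduced, D.comul_one]

theorem reduced_succ_apply (D : UnitalMagCoalgebra K m H) (k : ℕ) (x : H) :
    D.reduced (k + 1) x = D.comul (k + 1) x -
      ∑ l ∈ Finset.range (k + 1), ∑ e : Fin l ↪o Fin (k + 1), ins K D.one e (D.reduced l x) := by
  rw [UnitalMagCoalgebra.reduced, LinearMap.sub_apply, Finset.sum_range]
  simp

theorem extend_fin_one {γ : Type*} {k : ℕ} (e : Fin 1 ↪o Fin k) (x o : γ) :
    Function.extend e (fun _ => x) (fun _ => o) = Function.update (fun _ => o) (e 0) x := by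
  have h := extend_update e.injective (fun _ : Fin 1 => o) (fun _ : Fin k => o) 0 x
  have h1 : Function.update (fun _ : Fin 1 => o) 0 x = fun _ => x := by
    funext i; rw [Subsingleton.elim i 0]; simp
  have h2 : Function.extend e (fun _ : Fin 1 => o) (fun _ => o) = fun _ => o := by
    funext b
    by_cases hb : ∃ c, e c = b
    · obtain ⟨c, rfl⟩ := hb
      rw [e.injective.extend_apply]
    · rw [Function.extend_apply' _ _ _ hb]
  rw [h1, h2] at h
  exact h

/-- The increasing maps `{1} → {1..k}` are the elements of `{1..k}`. -/
def oneEmb (k : ℕ) : (Fin 1 ↪o Fin k) ≃ Fin k where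
  toFun e := e 0
  invFun i := OrderEmbedding.ofStrictMono (fun _ => i) (fun a b h => by
    exact absurd h (by rw [Subsingleton.elim a b]; exact lt_irrefl _))
  left_inv e := by
    ext i
    rw [Subsingleton.elim i 0]
    rfl
  right_inv i := rfl

theorem sum_oneEmb {M γ : Type*} [AddCommMonoid M] {k : ℕ} (f : (Fin k → γ) → M) (x o : γ) :
    ∑ e : Fin 1 ↪o Fin k, f (Function.extend e (fun _ => x) fun _ => o) =
      ∑ i : Fin k, f (Function.update (fun _ => o) i x) := by
  refine Fintype.sum_equiv (oneEmb k) _ _ fun e => ?_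
  rw [extend_fin_one]
  rfl

/-- An element whose co-operations are all of the form `∑_i 1^{⊗ i} ⊗ y ⊗ 1^{⊗ (k - i - 1)}` is
primitive. -/
theorem mem_prim_of_comul (D : UnitalMagCoalgebra K m H) (y : H)
    (hy : ∀ k, 2 ≤ k → k ≤ m → D.comul k y =
      ∑ i : Fin k, PiTensorProduct.tprod K (Function.update (fun _ => D.one) i y)) :
    y ∈ D.prim := by
  have key : ∀ k, 2 ≤ k → k ≤ m → D.reduced k y = 0 := by
    intro k
    induction k using Nat.strong_induction_on with
    | _ k ih =>
      intro h2 hm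
      obtain ⟨k, rfl⟩ : ∃ j, k = j + 2 := ⟨k - 2, by omega⟩
      rw [reduced_succ_apply, hy _ h2 hm,
        Finset.sum_eq_single (s := Finset.range (k + 2)) 1]
      · simp only [reduced_one, ins_tprod]
        rw [sum_oneEmb (f := fun w => PiTensorProduct.tprod K w), sub_self]
      · intro l hl h1
        refine Finset.sum_eq_zero fun e _ => ?_
        have hl' := Finset.mem_range.mp hl
        rcases Nat.lt_or_ge l 2 with h | h
        · obtain rfl : l = 0 := by omega
          simp [UnitalMagCoalgebra.reduced]
        · rw [ih l hl' h (by omega), map_zero]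
      · simp
  simp only [UnitalMagCoalgebra.prim, Submodule.mem_iInf, LinearMap.mem_ker]
  exact fun k hk => key k hk.1 hk.2

/-- The linear map `ε^{⊗ k}`. -/
def counitPow (D : UnitalMagCoalgebra K m H) (k : ℕ) : (⨂[K] _ : Fin k, H) →ₗ[K] K :=
  PiTensorProduct.lift ((MultilinearMap.mkPiAlgebra K (Fin k) K).compLinearMap fun _ => D.counit)

theorem counitPow_tprod (D : UnitalMagCoalgebra K m H) (k : ℕ) (v : Fin k → H) :
    counitPow D k (PiTensorProduct.tprod K v) = ∏ i, D.counit (v i) := by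
  simp [counitPow]

theorem counitPow_comul_two (D : UnitalMagCoalgebra K m H) (hm : 2 ≤ m) (x : H) :
    counitPow D 2 (D.comul 2 x) = D.counit x := by
  have h : counitPow D 2 = counitPow D 1 ∘ₗ contract D.counit 0 := by
    ext v
    simp [counitPow_tprod, contract_tprod]
  rw [h, LinearMap.comp_apply, D.comul_counit 1 le_rfl hm, D.comul_one, counitPow_tprod]
  simp

theorem counitPow_update (D : UnitalMagCoalgebra K m H) (k : ℕ) (i : Fin k) (x : H) :
    counitPow D k (PiTensorProduct.tprod K (Function.update (fun _ => D.one) i x)) =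
      D.counit x := by
  rw [counitPow_tprod, Finset.prod_eq_single i]
  · simp
  · intro j _ hj
    simp [hj, D.counit_unit]
  · simp

theorem counit_eq_zero_of_mem_prim (D : UnitalMagCoalgebra K m H) (hm : 2 ≤ m) {x : H}
    (hx : x ∈ D.prim) : D.counit x = 0 := by
  simp only [UnitalMagCoalgebra.prim, Submodule.mem_iInf, LinearMap.mem_ker] at hx
  have h := hx 2 ⟨le_rfl, hm⟩
  rw [reduced_succ_apply, Finset.sum_range_succ, Finset.sum_range_one] at h
  simp only [reduced_one, ins_tprod] at h
  rw [sum_oneEmb (f := fun w => PiTensorProduct.tprod K w)] at h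
  have h' := congrArg (counitPow D 2) h
  simp only [UnitalMagCoalgebra.reduced, LinearMap.zero_apply, map_zero, Finset.sum_const_zero,
    zero_add, map_sub, map_sum] at h'
  rw [counitPow_comul_two D hm] at h'
  simp only [counitPow_update] at h'
  simp at h'
  linear_combination -h'

theorem counit_mu (B : UnitalMagBialgebra K m n H) (hm : 2 ≤ m) (l : ℕ) (h2 : 2 ≤ l) (hl : l ≤ n)
    (x : Fin l → H) (hx : ∀ i, B.counit (x i) = 0) : B.counit (B.mu l x) = 0 := by
  have h := congrArg (counitPow B.toUnitalMagCoalgebra 2) (B.compat 2 le_rfl hm l h2 hl x hx)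
  rw [counitPow_comul_two _ hm, map_add, map_sum, map_sum,
    Finset.sum_eq_zero (s := (Finset.univ : Finset (Fin l ↪o Fin 2)))] at h
  · have h' : B.counit (B.mu l x) = ∑ _i : Fin 2, B.counit (B.mu l x) := by
      rw [add_zero] at h
      exact h.trans (Finset.sum_congr rfl fun i _ =>
        counitPow_update B.toUnitalMagCoalgebra 2 i _)
    rw [Fin.sum_univ_two] at h'
    linear_combination -h'
  · intro e _
    rw [counitPow_tprod]
    refine Finset.prod_eq_zero (Finset.mem_univ (e ⟨0, by omega⟩)) ?_
    rw [e.injective.extend_apply]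
    exact hx _

theorem counit_treeOp (B : UnitalMagBialgebra K m n H) (hm : 2 ≤ m) (t : PTree (Set.Icc 2 n))
    (v : t.Leaves → H) (hv : ∀ l, B.counit (v l) = 0) : B.counit (treeOp B.mu t v) = 0 := by
  induction t with
  | leaf => exact hv ()
  | node k hk ts ih =>
    exact B.counit_mu hm k hk.1 hk.2 _ fun i => ih i _ fun l => hv ⟨i, l⟩

theorem treeOp_mem_prim (B : UnitalMagBialgebra K m n H) (t : PTree (Set.Icc 2 n))
    (ht : t.RootNotIn (Set.Icc 2 m)) (v : t.Leaves → B.prim) :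
    treeOp B.mu t (fun l => (v l : H)) ∈ B.prim := by
  cases t with
  | leaf => exact (v ()).2
  | node l hl ts =>
    refine mem_prim_of_comul _ _ fun k h2 hm => ?_
    have hm2 := h2.trans hm
    have hlm : m < l := by
      by_contra h
      exact ht ⟨hl.1, not_lt.mp h⟩
    refine (B.compat k h2 hm l hl.1 hl.2 _ fun i => B.counit_treeOp hm2 _ _ fun a =>
      counit_eq_zero_of_mem_prim _ hm2 (v ⟨i, a⟩).2).trans ?_
    have : IsEmpty (Fin l ↪o Fin k) := ⟨fun e => by
      have := Fintype.card_le_of_injective e e.injective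
      simp at this
      omega⟩
    rw [Finset.univ_eq_empty (α := Fin l ↪o Fin k), Finset.sum_empty, add_zero]
    rfl

/-- The `Mag^{m ⊂ n}`-algebra structure of the primitive part: the operations are the
composites of the `mu k` along trees whose root has an arity in `{m+1, …, n}`. -/
def primAlgebra (B : UnitalMagBialgebra K m n H) :
    MagRootAlgebra K (Set.Icc 2 m) (Set.Icc 2 n) B.prim where
  op t ht :=
    ((treeOp B.mu t).compLinearMap fun _ => B.prim.subtype).codRestrict B.prim
      fun v => B.treeOp_mem_prim t ht v
  op_leaf _ _ := rfl
  op_plug t _ s _ _ v := Subtype.ext (treeOp_plug B.mu t s fun l => (v l : H))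

end UnitalMagBialgebra

/-! ### Free magmatic algebras and the enveloping bialgebra -/

section Free

variable (K : Type v) [Field K] (S : Set ℕ) (V : Type u) [AddCommGroup V] [Module K V]

/-- The space `Mag^S(V) = ⨁_t V^{⊗ leaves of t}` of planar trees with inner arities in `S` and
leaves labelled by `V`. -/
abbrev Mag : Type (max u v) := ⨁ t : PTree S, ⨂[K] _ : t.Leaves, V

open scoped Classical in
/-- A tree with labelled leaves, as an element of `Mag^S(V)` (linear in the tensor of labels). -/
def labelled (t : PTree S) : (⨂[K] _ : t.Leaves, V) →ₗ[K] Mag K S V :=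
  DirectSum.lof K (PTree S) (fun t => ⨂[K] _ : t.Leaves, V) t

variable {S V}

/-- The `k`-grafting of labelled trees of given shapes `ts 0, …, ts (k - 1)`. -/
def graftTree (k : ℕ) (hk : k ∈ S) (ts : Fin k → PTree S) :
    MultilinearMap K (fun i => ⨂[K] _ : (ts i).Leaves, V) (Mag K S V) :=
  (labelled K S V (.node k hk ts)).compMultilinearMap (treeConcat K hk ts)

/-- The `k`-grafting of labelled trees, for `k ∈ S`; it makes `Mag^S(V)` the free `S`-magmatic
algebra on `V`. -/
def graft (k : ℕ) (hk : k ∈ S) : MultilinearMap K (fun _ : Fin k => Mag K S V) (Mag K S V) :=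
  MultilinearMap.fromDirectSumEquiv (κ := fun _ : Fin k => PTree S)
    (graftTree K k hk)

theorem graft_labelled (k : ℕ) (hk : k ∈ S) (ts : Fin k → PTree S)
    (w : ∀ i, ⨂[K] _ : (ts i).Leaves, V) :
    graft K k hk (fun i => labelled K S V (ts i) (w i)) =
      labelled K S V (.node k hk ts) (treeConcat K hk ts w) := by
  classical
  exact MultilinearMap.fromDirectSumEquiv_lof (R := K) (κ := fun _ : Fin k => PTree S)
    (M := fun _ t => ⨂[K] _ : t.Leaves, V) (M' := Mag K S V) (graftTree K k hk) ts w

/-- The tensor of the `l` labelled subtrees at the root of a labelled tree. -/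
def subtrees {l : ℕ} (hl : l ∈ S) (ts : Fin l → PTree S) :
    (⨂[K] _ : (PTree.node l hl ts).Leaves, V) →ₗ[K] ⨂[K] _ : Fin l, Mag K S V :=
  PiTensorProduct.lift ((PiTensorProduct.tprod K).compMultilinearMap fun i =>
    (labelled K S V (ts i)).compMultilinearMap (PiTensorProduct.tprod K))

theorem subtrees_tprod {l : ℕ} (hl : l ∈ S) (ts : Fin l → PTree S)
    (v : (i : Fin l) → (ts i).Leaves → V) :
    subtrees K hl ts
        (PiTensorProduct.tprod K fun p : (PTree.node l hl ts).Leaves => v p.1 p.2) =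
      PiTensorProduct.tprod K
        fun i => labelled K S V (ts i) (PiTensorProduct.tprod K (v i)) :=
  PiTensorProduct.lift.tprod _

/-- The `k`-ungrafting of a labelled tree: the tensor of the `k` subtrees at the root if the root
has arity `k`, and `0` otherwise. -/
def ungraftTree (k : ℕ) : (t : PTree S) → (⨂[K] _ : t.Leaves, V) →ₗ[K] ⨂[K] _ : Fin k, Mag K S V
  | .leaf => 0
  | .node l hl ts =>
    if h : l = k then
      (PiTensorProduct.reindex K (fun _ => Mag K S V) (finCongr h)).toLinearMap ∘ₗ
        subtrees K hl ts
    else 0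

open scoped Classical in
/-- The `k`-ungrafting of labelled trees. -/
def ungraft (k : ℕ) : Mag K S V →ₗ[K] ⨂[K] _ : Fin k, Mag K S V :=
  DirectSum.toModule K (PTree S) _ (ungraftTree K k)

theorem ungraft_labelled (k : ℕ) (t : PTree S) (w : ⨂[K] _ : t.Leaves, V) :
    ungraft K k (labelled K S V t w) = ungraftTree K k t w := by
  rw [ungraft, labelled, DirectSum.toModule_lof]

theorem mag_multilinear_ext {k : ℕ} {N : Type*} [AddCommMonoid N] [Module K N]
    {f g : MultilinearMap K (fun _ : Fin k => Mag K S V) N}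
    (h : ∀ (ts : Fin k → PTree S) (v : ∀ i, (ts i).Leaves → V),
      f (fun i => labelled K S V (ts i) (PiTensorProduct.tprod K (v i))) =
        g (fun i => labelled K S V (ts i) (PiTensorProduct.tprod K (v i)))) : f = g := by
  classical
  refine MultilinearMap.directSum_ext fun ts => ?_
  refine MultilinearMap.ext_of_span_eq_top (g := fun i => fun v : (ts i).Leaves → V =>
    PiTensorProduct.tprod K v) (fun i => PiTensorProduct.span_tprod_eq_top) fun v => ?_
  exact h ts v

theorem ungraft_graft_self (k : ℕ) (hk : k ∈ S) (x : Fin k → Mag K S V) :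
    ungraft K k (graft K k hk x) = PiTensorProduct.tprod K x := by
  have h : (ungraft K (S := S) (V := V) k).compMultilinearMap (graft K (V := V) k hk) = PiTensorProduct.tprod K := by
    refine mag_multilinear_ext (V := V) K fun ts v => ?_
    simp only [LinearMap.compMultilinearMap_apply]
    rw [graft_labelled, ungraft_labelled, treeConcat_tprod]
    simp only [ungraftTree, dif_pos, LinearMap.comp_apply]
    rw [subtrees_tprod]
    simp
  exact congrArg (fun f => f x) h

theorem ungraft_graft_of_ne (k l : ℕ) (hl : l ∈ S) (h : l ≠ k) (x : Fin l → Mag K S V) :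
    ungraft K k (graft K l hl x) = 0 := by
  have h : (ungraft K (S := S) (V := V) k).compMultilinearMap (graft K (V := V) l hl) = 0 := by
    refine mag_multilinear_ext (V := V) K fun ts v => ?_
    simp only [LinearMap.compMultilinearMap_apply]
    rw [graft_labelled, ungraft_labelled]
    simp [ungraftTree, h]
  exact congrArg (fun f => f x) h

end Free

/-! #### Non-unital magmatic bialgebras and adjunction of a unit -/

/-- A (non-unital) `(T,S)`-magmatic bialgebra: operations `mu k` for `k ∈ S`, co-operations `comul k`
for `k ∈ T`, such that `comul k ∘ mu k = Id` and `comul k ∘ mu l = 0` for `k ≠ l`. (The values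
`mu k` for `k ∉ S` and `comul k` for `k ∉ T` play no role.) -/
structure MagBialgebra (K : Type v) [Field K] (T S : Set ℕ) (M : Type u) [AddCommGroup M]
    [Module K M] where
  mu : (k : ℕ) → MultilinearMap K (fun _ : Fin k => M) M
  comul : (k : ℕ) → M →ₗ[K] ⨂[K] _ : Fin k, M
  comul_mu_self : ∀ k ∈ T, k ∈ S → ∀ x : Fin k → M,
    comul k (mu k x) = PiTensorProduct.tprod K x
  comul_mu_of_ne : ∀ k ∈ T, ∀ l ∈ S, l ≠ k → ∀ x : Fin l → M, comul k (mu l x) = 0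

theorem sum_avoid {M : Type*} [AddCommMonoid M] {j k : ℕ} (i : Fin (k + 1))
    (F : (Fin j ↪o Fin (k + 1)) → M) (hF : ∀ e, (∃ a, e a = i) → F e = 0) :
    ∑ e, F e = ∑ e : Fin j ↪o Fin k, F (e.trans (Fin.succAboveOrderEmb i)) := by
  symm
  refine Fintype.sum_of_injective (fun e => e.trans (Fin.succAboveOrderEmb i)) ?_ _ _ ?_
    fun _ => rfl
  · intro e e' h
    ext a
    have := DFunLike.congr_fun h a
    exact congrArg Fin.val ((Fin.succAboveOrderEmb i).injective this)
  · intro e he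
    refine hF e ?_
    by_contra hne
    push Not at hne
    choose g hg using fun a => Fin.exists_succAbove_eq (hne a)
    refine he ⟨OrderEmbedding.ofStrictMono g fun a b hab => ?_, ?_⟩
    · rw [← (Fin.succAboveOrderEmb i).lt_iff_lt]
      simpa [hg] using hab
    · ext a
      exact congrArg Fin.val (hg a)

theorem orderEmb_self_eq {k : ℕ} (e : Fin k ↪o Fin k) : e = RelEmbedding.refl _ := by
  ext a
  have h : (e : Fin k → Fin k) = id := (StrictMono.range_inj e.strictMono strictMono_id).mp (by
    rw [Set.range_id, (Finite.injective_iff_surjective.mp e.injective).range_eq])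
  exact congrArg Fin.val (congrFun h a)

theorem sum_orderEmb_zero {M : Type*} [AddCommMonoid M] {k : ℕ} (F : (Fin 0 ↪o Fin k) → M) :
    ∑ e, F e = F OrderEmbedding.ofIsEmpty := by
  refine Fintype.sum_eq_single _ fun e he => absurd (DFunLike.ext _ _ fun i => i.elim0) he

theorem sum_orderEmb_self {M : Type*} [AddCommMonoid M] {k : ℕ} (F : (Fin k ↪o Fin k) → M) :
    ∑ e, F e = F (RelEmbedding.refl _) := by
  refine Fintype.sum_eq_single _ fun e he => absurd (orderEmb_self_eq e) he

theorem extend_comp_apply {α β γ δ : Type*} {f : α → β} {g : β → δ} (hg : Function.Injective g)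
    (v : α → γ) (o : γ) (b : β) :
    Function.extend (fun a => g (f a)) v (fun _ => o) (g b) =
      Function.extend f v (fun _ => o) b := by
  classical
  simp only [Function.extend_def, hg.eq_iff]

theorem exists_avoid {j k : ℕ} (h : j < k) (e : Fin j ↪o Fin k) : ∃ i, ∀ a, e a ≠ i := by
  by_contra hne
  push Not at hne
  have := Fintype.card_le_of_surjective e hne
  simp at this
  omega

section

variable {P Q : Type*} {j k : ℕ} (e : Fin j ↪o Fin k) (x : Fin k → P × Q)

theorem snd_update_hit (a : Fin j) (w : P × Q) :
    (fun b => (Function.update x (e a) w (e b)).2) =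
      Function.update (fun b => (x (e b)).2) a w.2 := by
  funext b
  by_cases h : b = a
  · subst h; simp
  · simp [h]

theorem snd_update_avoid {i : Fin k} (hi : ∀ a, e a ≠ i) (w : P × Q) :
    (fun b => (Function.update x i w (e b)).2) = fun b => (x (e b)).2 := by
  funext b
  rw [Function.update_of_ne (hi b)]

theorem prod_update_hit [CommMonoid P] [DecidablePred fun i => ∀ a, e a ≠ i] (a : Fin j) (w : P × Q) :
    (∏ i with ∀ a, e a ≠ i, (Function.update x (e a) w i).1) =
      ∏ i with ∀ a, e a ≠ i, (x i).1 := by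
  refine Finset.prod_congr rfl fun i hi => ?_
  rw [Function.update_of_ne ((Finset.mem_filter.mp hi).2 a).symm]

theorem prod_update_avoid [CommMonoid P] [DecidablePred fun i => ∀ a, e a ≠ i] {i : Fin k}
    (hi : ∀ a, e a ≠ i) (w : P × Q) :
    (∏ i' with ∀ a, e a ≠ i', (Function.update x i w i').1) =
      w.1 * ∏ i' ∈ (Finset.univ.filter fun i' => ∀ a, e a ≠ i').erase i, (x i').1 := by
  rw [← Finset.mul_prod_erase _ _ (Finset.mem_filter.mpr ⟨Finset.mem_univ i, hi⟩),
    Function.update_self]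
  congr 1
  refine Finset.prod_congr rfl fun i' hi' => ?_
  rw [Function.update_of_ne (Finset.ne_of_mem_erase hi')]

end

namespace MagBialgebra

variable {K : Type v} [Field K] {T S : Set ℕ} {M : Type u} [AddCommGroup M] [Module K M]

/-- The operation of arity `j` of `M`, with values in `K 1 ⊕ M = K × M`; in arity `1` it is the
identity, and in arity `0` it is the unit. -/
def unitMuAux (N : MagBialgebra K T S M) : (j : ℕ) → MultilinearMap K (fun _ : Fin j => M) (K × M)
  | 0 => MultilinearMap.constOfIsEmpty K _ (1, 0)
  | 1 => (LinearMap.inr K K M).compMultilinearMap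
      (MultilinearMap.ofSubsingleton K M M (0 : Fin 1) LinearMap.id)
  | j + 2 => (LinearMap.inr K K M).compMultilinearMap (N.mu (j + 2))

open scoped Classical in
/-- The contribution to `μ_k(c_1 1 + y_1, …, c_k 1 + y_k)` of the terms `y_i` for `i` in the image of
`e` and of the terms `c_i 1` for the other indices `i`. -/
def unitMuTerm (N : MagBialgebra K T S M) {j k : ℕ} (e : Fin j ↪o Fin k) :
    MultilinearMap K (fun _ : Fin k => K × M) (K × M) :=
  MultilinearMap.mk'
    (fun x => (∏ i with ∀ a, e a ≠ i, (x i).1) • N.unitMuAux j fun a => (x (e a)).2)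
    (fun x i y z => by
      by_cases h : ∃ a, e a = i
      · obtain ⟨a, rfl⟩ := h
        simp [prod_update_hit, snd_update_hit]
      · push Not at h
        simp [prod_update_avoid _ _ h, snd_update_avoid _ _ h, add_mul, add_smul])
    (fun x i c y => by
      by_cases h : ∃ a, e a = i
      · obtain ⟨a, rfl⟩ := h
        simp [prod_update_hit, snd_update_hit, smul_comm c]
      · push Not at h
        simp [prod_update_avoid _ _ h, snd_update_avoid _ _ h, mul_assoc, mul_smul])

/-- The unitary extension of the operations of `M` to `K 1 ⊕ M`. -/
def unitMu (N : MagBialgebra K T S M) (k : ℕ) :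
    MultilinearMap K (fun _ : Fin k => K × M) (K × M) :=
  ∑ j ∈ Finset.range (k + 1), ∑ e : Fin j ↪o Fin k, N.unitMuTerm e

/-- The co-operation of arity `j` of `M`, with the convention that it is the identity in arity
`1`. -/
def unitComulAux (N : MagBialgebra K T S M) : (j : ℕ) → M →ₗ[K] ⨂[K] _ : Fin j, M
  | 0 => 0
  | 1 => (PiTensorProduct.subsingletonEquiv (R := K) (s := fun _ : Fin 1 => M) 0).symm.toLinearMap
  | j + 2 => N.comul (j + 2)

/-- The unitary extension `Δ_k` of the co-operations `δ_j` of `M` to `K 1 ⊕ M`: one has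
`Δ_k(1) = 1^{⊗ k}`, and `Δ_k(y)` is the sum of `σ(δ_j(y), 1^{⊗ (k-j)})` over `1 ≤ j ≤ k`
and `σ ∈ Sh(j,k-j)` for `y ∈ M`. -/
def unitComul (N : MagBialgebra K T S M) (k : ℕ) : K × M →ₗ[K] ⨂[K] _ : Fin k, (K × M) :=
  (LinearMap.fst K K M).smulRight (PiTensorProduct.tprod K fun _ => ((1, 0) : K × M)) +
    ∑ j ∈ Finset.range (k + 1), ∑ e : Fin j ↪o Fin k,
      ins K ((1, 0) : K × M) e ∘ₗ PiTensorProduct.map (fun _ => LinearMap.inr K K M) ∘ₗ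
        N.unitComulAux j ∘ₗ LinearMap.snd K K M

theorem unitMu_apply (N : MagBialgebra K T S M) (k : ℕ) (x : Fin k → K × M) :
    N.unitMu k x = ∑ j ∈ Finset.range (k + 1), ∑ e : Fin j ↪o Fin k, N.unitMuTerm e x := by
  simp [unitMu]

theorem unitComul_apply (N : MagBialgebra K T S M) (k : ℕ) (x : K × M) :
    N.unitComul k x = x.1 • PiTensorProduct.tprod K (fun _ => ((1, 0) : K × M)) +
      ∑ j ∈ Finset.range (k + 1), ∑ e : Fin j ↪o Fin k,
        ins K ((1, 0) : K × M) e
          (PiTensorProduct.map (fun _ => LinearMap.inr K K M) (N.unitComulAux j x.2)) := by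
  simp [unitComul]

theorem unitMuTerm_apply (N : MagBialgebra K T S M) {j k : ℕ} (e : Fin j ↪o Fin k)
    (x : Fin k → K × M) [DecidablePred fun i => ∀ a, e a ≠ i] : N.unitMuTerm e x =
      (∏ i with ∀ a, e a ≠ i, (x i).1) • N.unitMuAux j fun a => (x (e a)).2 := by
  simp only [unitMuTerm, MultilinearMap.mk'_apply]
  congr!

theorem unitMu_one (N : MagBialgebra K T S M) (x : Fin 1 → K × M) : N.unitMu 1 x = x 0 := by
  classical
  rw [unitMu_apply, Finset.sum_range_succ, Finset.sum_range_one, sum_orderEmb_self,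
    sum_orderEmb_zero, unitMuTerm_apply, unitMuTerm_apply]
  simp [unitMuAux]

theorem unitMu_unit (N : MagBialgebra K T S M) (k : ℕ) (i : Fin (k + 1)) (x : Fin k → K × M) :
    N.unitMu (k + 1) (Fin.insertNth (α := fun _ => K × M) i (1, 0) x) = N.unitMu k x := by
  classical
  rw [unitMu_apply, unitMu_apply, Finset.sum_range_succ]
  have h0 (j : ℕ) (e : Fin j ↪o Fin (k + 1)) (he : ∃ a, e a = i) :
      N.unitMuTerm e (Fin.insertNth (α := fun _ => K × M) i (1, 0) x) = 0 := by
    obtain ⟨a, rfl⟩ := he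
    rw [unitMuTerm_apply]
    have : N.unitMuAux j (fun b =>
        (Fin.insertNth (α := fun _ => K × M) (e a) (1, 0) x (e b)).2) = 0 :=
      MultilinearMap.map_coord_zero _ a (by simp)
    rw [this, smul_zero]
  rw [sum_avoid i _ (h0 (k + 1))]
  have : IsEmpty (Fin (k + 1) ↪o Fin k) := ⟨fun e => by
    have := Fintype.card_le_of_injective e e.injective
    simp at this⟩
  rw [Finset.univ_eq_empty (α := Fin (k + 1) ↪o Fin k), Finset.sum_empty, add_zero]
  refine Finset.sum_congr rfl fun j _ => ?_
  rw [sum_avoid i _ (h0 j)]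
  refine Finset.sum_congr rfl fun e _ => ?_
  rw [unitMuTerm_apply, unitMuTerm_apply]
  congr 1
  · rw [Finset.prod_filter, Fin.prod_univ_succAbove _ i, Finset.prod_filter]
    simp
  · simp

theorem unitComul_one (N : MagBialgebra K T S M) (x : K × M) :
    N.unitComul 1 x = PiTensorProduct.tprod K fun _ => x := by
  have h (w : K × M) : PiTensorProduct.tprod K (fun _ : Fin 1 => w) =
      (PiTensorProduct.subsingletonEquiv (R := K) (s := fun _ : Fin 1 => K × M) 0).symm w := by
    simp
  have h1 : N.unitComulAux 1 x.2 = PiTensorProduct.tprod K fun _ => x.2 := by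
    simp [unitComulAux]
  have h2 : PiTensorProduct.map (fun _ : Fin 0 => LinearMap.inr K K M) (N.unitComulAux 0 x.2) = 0 :=
    map_zero _
  have h3 : Function.extend (RelEmbedding.refl (· ≤ ·) : Fin 1 ↪o Fin 1)
      (fun _ => (LinearMap.inr K K M) x.2) (fun _ => ((1, 0) : K × M)) = fun _ => (0, x.2) := by
    exact Function.extend_id _ _
  rw [unitComul_apply, Finset.sum_range_succ, Finset.sum_range_one, sum_orderEmb_self, h1, h2,
    PiTensorProduct.map_tprod, ins_tprod, h3, h, h, h, ← map_smul]
  rw [Finset.sum_congr rfl fun e _ => map_zero (ins K ((1, 0) : K × M) e),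
    Finset.sum_const_zero, zero_add, ← map_add]
  simp

theorem contract_ins_hit {j k : ℕ} (i : Fin (k + 1)) (e : Fin j ↪o Fin (k + 1))
    (he : ∃ a, e a = i) (w : ⨂[K] _ : Fin j, M) :
    contract (LinearMap.fst K K M) i (ins K ((1, 0) : K × M) e
      (PiTensorProduct.map (fun _ => LinearMap.inr K K M) w)) = 0 := by
  obtain ⟨a, rfl⟩ := he
  induction w using PiTensorProduct.induction_on with
  | smul_tprod r v =>
    simp [ins_tprod, contract_tprod, PiTensorProduct.map_tprod, e.injective.extend_apply]
  | add x y hx hy => simp only [map_add, hx, hy, add_zero]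

theorem contract_ins_avoid {j k : ℕ} (i : Fin (k + 1)) (e : Fin j ↪o Fin k)
    (w : ⨂[K] _ : Fin j, K × M) :
    contract (LinearMap.fst K K M) i
      (ins K ((1, 0) : K × M) (e.trans (Fin.succAboveOrderEmb i)) w) =
      ins K ((1, 0) : K × M) e w := by
  induction w using PiTensorProduct.induction_on with
  | smul_tprod r v =>
    have h1 : Function.extend (fun a => i.succAbove (e a)) v (fun _ => ((1, 0) : K × M)) i =
        (1, 0) := Function.extend_apply' _ _ _ (by
      rintro ⟨a, ha⟩
      exact Fin.succAbove_ne i _ ha)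
    have h2 (b : Fin k) := extend_comp_apply (f := e) (Fin.succAbove_right_injective (p := i)) v
      ((1, 0) : K × M) b
    have h3 : ((e.trans (Fin.succAboveOrderEmb i) : Fin j ↪o Fin (k + 1)) : Fin j → Fin (k + 1)) =
        fun a => i.succAbove (e a) := rfl
    rw [map_smul, map_smul, map_smul, ins_tprod, ins_tprod, contract_tprod, h3, h1]
    simp only [h2]
    simp
  | add x y hx hy => simp only [map_add, hx, hy]

theorem unitComul_counit (N : MagBialgebra K T S M) (k : ℕ) (i : Fin (k + 1)) (x : K × M) :
    contract (LinearMap.fst K K M) i (N.unitComul (k + 1) x) = N.unitComul k x := by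
  rw [unitComul_apply, unitComul_apply, map_add, map_sum, Finset.sum_range_succ]
  simp only [map_sum]
  rw [sum_avoid i _ (fun e he => contract_ins_hit i e he _)]
  have : IsEmpty (Fin (k + 1) ↪o Fin k) := ⟨fun e => by
    have := Fintype.card_le_of_injective e e.injective
    simp at this⟩
  rw [Finset.univ_eq_empty (α := Fin (k + 1) ↪o Fin k), Finset.sum_empty, add_zero]
  congr 1
  · rw [map_smul, contract_tprod]
    simp
  · refine Finset.sum_congr rfl fun j _ => ?_
    rw [sum_avoid i _ (fun e he => contract_ins_hit i e he _)]
    exact Finset.sum_congr rfl fun e _ => contract_ins_avoid i e _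

theorem unitMu_inr (N : MagBialgebra K T S M) (l : ℕ) (hl2 : 2 ≤ l) (y : Fin l → M) :
    N.unitMu l (fun i => ((0, y i) : K × M)) = (0, N.mu l y) := by
  classical
  obtain ⟨l, rfl⟩ : ∃ j, l = j + 2 := ⟨l - 2, by omega⟩
  rw [unitMu_apply, Finset.sum_range_succ, Finset.sum_eq_zero, sum_orderEmb_self,
    unitMuTerm_apply, Finset.prod_filter]
  · simp [unitMuAux]
  · intro j hj
    refine Finset.sum_eq_zero fun e _ => ?_
    obtain ⟨i, hi⟩ := exists_avoid (Finset.mem_range.mp hj) e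
    rw [unitMuTerm_apply, Finset.prod_eq_zero (Finset.mem_filter.mpr ⟨Finset.mem_univ i, hi⟩) rfl,
      zero_smul]

theorem unit_compat (N : MagBialgebra K T S M) (k : ℕ) (hk2 : 2 ≤ k) (l : ℕ)
    (hl : l ∈ S) (hl2 : 2 ≤ l) (hT : ∀ j, 2 ≤ j → j ≤ k → j ∈ T) (x : Fin l → K × M)
    (hx : ∀ i, (x i).1 = 0) :
    N.unitComul k (N.unitMu l x) =
      ∑ i : Fin k, PiTensorProduct.tprod K
        (Function.update (fun _ => ((1, 0) : K × M)) i (N.unitMu l x)) +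
      ∑ e : Fin l ↪o Fin k, PiTensorProduct.tprod K
        (Function.extend e x fun _ => ((1, 0) : K × M)) := by
  obtain ⟨y, rfl⟩ : ∃ y : Fin l → M, x = fun i => (0, y i) :=
    ⟨fun i => (x i).2, funext fun i => Prod.ext (hx i) rfl⟩
  rw [unitMu_inr N l hl2, unitComul_apply]
  have h1 : ∑ e : Fin 1 ↪o Fin k, ins K ((1, 0) : K × M) e
      (PiTensorProduct.map (fun _ => LinearMap.inr K K M) (N.unitComulAux 1 (N.mu l y))) =
      ∑ i : Fin k, PiTensorProduct.tprod K
        (Function.update (fun _ => ((1, 0) : K × M)) i (0, N.mu l y)) := by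
    rw [← UnitalMagBialgebra.sum_oneEmb (f := fun w => PiTensorProduct.tprod K w)]
    refine Finset.sum_congr rfl fun e _ => ?_
    have : N.unitComulAux 1 (N.mu l y) = PiTensorProduct.tprod K fun _ => N.mu l y := by
      simp [unitComulAux]
    rw [this, PiTensorProduct.map_tprod, ins_tprod]
    rfl
  have h2 (j : ℕ) (hj : j < k + 1) (h1 : j ≠ 1) (hjl : j ≠ l) (e : Fin j ↪o Fin k) :
      ins K ((1, 0) : K × M) e
        (PiTensorProduct.map (fun _ => LinearMap.inr K K M)
          (N.unitComulAux j (N.mu l y))) = 0 := by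
    have : N.unitComulAux j (N.mu l y) = 0 := by
      match j, hj, h1, hjl with
      | 0, _, _, _ => rfl
      | 1, _, h1, _ => exact absurd rfl h1
      | j + 2, hj, _, hjl =>
        exact N.comul_mu_of_ne _ (hT _ (by omega) (by omega)) l hl hjl.symm y
    rw [this, map_zero, map_zero]
  have h3 (hlk : l ≤ k) (e : Fin l ↪o Fin k) :
      ins K ((1, 0) : K × M) e
        (PiTensorProduct.map (fun _ => LinearMap.inr K K M)
          (N.unitComulAux l (N.mu l y))) = PiTensorProduct.tprod K
        (Function.extend e (fun i => (0, y i)) fun _ => ((1, 0) : K × M)) := by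
    have : N.unitComulAux l (N.mu l y) = PiTensorProduct.tprod K y := by
      obtain ⟨l, rfl⟩ : ∃ j, l = j + 2 := ⟨l - 2, by omega⟩
      exact N.comul_mu_self _ (hT _ hl2 hlk) hl y
    rw [this, PiTensorProduct.map_tprod, ins_tprod]
    rfl
  simp only [zero_smul, zero_add]
  rw [← Finset.add_sum_erase _ _ (Finset.mem_range.mpr (show 1 < k + 1 by omega)), h1]
  congr 1
  by_cases hlk : l ≤ k
  · rw [Finset.sum_eq_single l]
    · exact Finset.sum_congr rfl fun e _ => h3 hlk e
    · intro j hj hjl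
      have hj' := Finset.mem_erase.mp hj
      exact Finset.sum_eq_zero fun e _ => h2 j (Finset.mem_range.mp hj'.2) hj'.1 hjl e
    · intro h
      exact absurd (Finset.mem_erase.mpr ⟨by omega, Finset.mem_range.mpr (by omega)⟩) h
  · have : IsEmpty (Fin l ↪o Fin k) := ⟨fun e => by
      have := Fintype.card_le_of_injective e e.injective
      simp at this
      omega⟩
    rw [Finset.univ_eq_empty (α := Fin l ↪o Fin k), Finset.sum_empty]
    refine Finset.sum_eq_zero fun j hj => ?_
    have hj' := Finset.mem_erase.mp hj
    have hj2 := Finset.mem_range.mp hj'.2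
    exact Finset.sum_eq_zero fun e _ => h2 j hj2 hj'.1 (by omega) e

/-- The unital `(m,n)`-magmatic bialgebra `K 1 ⊕ M` obtained by adjoining a unit. -/
def adjoinUnit {m n : ℕ} (N : MagBialgebra K (Set.Icc 2 m) (Set.Icc 2 n) M) :
    UnitalMagBialgebra K m n (K × M) where
  one := (1, 0)
  mu := N.unitMu
  mu_one := N.unitMu_one
  mu_unit k _ _ i x := N.unitMu_unit k i x
  counit := LinearMap.fst K K M
  counit_unit := rfl
  comul := N.unitComul
  comul_one := N.unitComul_one
  comul_unit k _ _ := by simp [unitComul_apply]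
  comul_counit k _ _ i x := N.unitComul_counit k i x
  compat k h2 hm l h2' hn x hx := N.unit_compat k h2 l ⟨h2', hn⟩ h2'
    (fun _ h h' => ⟨h, h'.trans hm⟩) x hx

end MagBialgebra

/-! #### The enveloping bialgebra -/

section Quotient

variable {K : Type v} [Field K] {M N : Type*} [AddCommGroup M] [Module K M] [AddCommGroup N]
  [Module K N]

theorem multilinear_sub_mem {k : ℕ} (f : MultilinearMap K (fun _ : Fin k => M) M)
    (J : Submodule K M) (hf : ∀ x i, x i ∈ J → f x ∈ J) (x y : Fin k → M)
    (h : ∀ i, x i - y i ∈ J) : f x - f y ∈ J := by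
  classical
  have key : ∀ s : Finset (Fin k), f (s.piecewise x y) - f y ∈ J := by
    intro s
    induction s using Finset.induction_on with
    | empty => simp
    | insert a s ha ih =>
      have h1 : f ((insert a s).piecewise x y) - f (s.piecewise x y) =
          f (Function.update (s.piecewise x y) a (x a - y a)) := by
        rw [Finset.piecewise_insert, f.map_update_sub]
        congr 2
        rw [eq_comm, Function.update_eq_self_iff]
        simp [ha]
      have h2 := J.add_mem (hf (Function.update (s.piecewise x y) a (x a - y a)) a (by simp [h a]))
        ih
      rw [← h1] at h2
      simpa using h2
  simpa using key Finset.univ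

theorem mkQ_out_eq {k : ℕ} (f : MultilinearMap K (fun _ : Fin k => M) M)
    (J : Submodule K M) (hf : ∀ x i, x i ∈ J → f x ∈ J) (x : Fin k → M ⧸ J) (v : Fin k → M)
    (h : ∀ i, J.mkQ (v i) = x i) : J.mkQ (f fun i => Quotient.out (x i)) = J.mkQ (f v) := by
  rw [← sub_eq_zero, ← map_sub, ← LinearMap.mem_ker, Submodule.ker_mkQ]
  refine multilinear_sub_mem f J hf _ _ fun i => ?_
  have h' : J.mkQ (Quotient.out (x i) - v i) = 0 := by
    rw [map_sub, h, sub_eq_zero]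
    exact Quotient.out_eq (x i)
  rwa [← LinearMap.mem_ker, Submodule.ker_mkQ] at h'

theorem mkQ_update {k : ℕ} (J : Submodule K M) (x : Fin k → M ⧸ J) (v : Fin k → M)
    (h : ∀ i, J.mkQ (v i) = x i) (a : Fin k) (y : M ⧸ J) (w : M) (hw : J.mkQ w = y) (i : Fin k) :
    J.mkQ (Function.update v a w i) = Function.update x a y i := by
  by_cases hi : i = a
  · subst hi; simpa using hw
  · simpa [hi] using h i

/-- The operation induced on the quotient by an ideal. -/
def quotOp {k : ℕ} (f : MultilinearMap K (fun _ : Fin k => M) M)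
    (J : Submodule K M) (hf : ∀ x i, x i ∈ J → f x ∈ J) :
    MultilinearMap K (fun _ : Fin k => M ⧸ J) (M ⧸ J) :=
  MultilinearMap.mk' (fun x => J.mkQ (f fun i => Quotient.out (x i)))
    (fun x a y z => by
      have hx (i : Fin k) : J.mkQ (Quotient.out (x i)) = x i := Quotient.out_eq (x i)
      have hy : J.mkQ (Quotient.out y) = y := Quotient.out_eq y
      have hz : J.mkQ (Quotient.out z) = z := Quotient.out_eq z
      rw [mkQ_out_eq f J hf _ _ (mkQ_update J x _ hx a _ _
          (by rw [map_add, hy, hz] : J.mkQ (Quotient.out y + Quotient.out z) = y + z)),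
        mkQ_out_eq f J hf _ _ (mkQ_update J x _ hx a _ _ hy),
        mkQ_out_eq f J hf _ _ (mkQ_update J x _ hx a _ _ hz), f.map_update_add, map_add])
    (fun x a c y => by
      have hx (i : Fin k) : J.mkQ (Quotient.out (x i)) = x i := Quotient.out_eq (x i)
      have hy : J.mkQ (Quotient.out y) = y := Quotient.out_eq y
      rw [mkQ_out_eq f J hf _ _ (mkQ_update J x _ hx a _ _
          (by rw [map_smul, hy] : J.mkQ (c • Quotient.out y) = c • y)),
        mkQ_out_eq f J hf _ _ (mkQ_update J x _ hx a _ _ hy), f.map_update_smul, map_smul])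

theorem quotOp_mkQ {k : ℕ} (f : MultilinearMap K (fun _ : Fin k => M) M)
    (J : Submodule K M) (hf : ∀ x i, x i ∈ J → f x ∈ J) (x : Fin k → M) :
    quotOp f J hf (fun i => J.mkQ (x i)) = J.mkQ (f x) :=
  mkQ_out_eq f J hf _ _ fun _ => rfl

/-- The co-operation induced on the quotient by a coideal. -/
def quotCoop {k : ℕ} (g : M →ₗ[K] ⨂[K] _ : Fin k, M) (J : Submodule K M)
    (hg : ∀ x ∈ J, PiTensorProduct.map (fun _ => J.mkQ) (g x) = 0) :
    (M ⧸ J) →ₗ[K] ⨂[K] _ : Fin k, (M ⧸ J) :=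
  J.liftQ (PiTensorProduct.map (fun _ => J.mkQ) ∘ₗ g) hg

theorem quotCoop_mkQ {k : ℕ} (g : M →ₗ[K] ⨂[K] _ : Fin k, M) (J : Submodule K M)
    (hg : ∀ x ∈ J, PiTensorProduct.map (fun _ => J.mkQ) (g x) = 0) (x : M) :
    quotCoop g J hg (J.mkQ x) = PiTensorProduct.map (fun _ => J.mkQ) (g x) := rfl

end Quotient

namespace MagRootAlgebra

variable {K : Type v} [Field K] {T S : Set ℕ} {A : Type u} [AddCommGroup A] [Module K A]

/-- The elements `t(a_1, …, a_r) - op t (a_1, …, a_r)` of the free `S`-magmatic algebra on `A`, for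
`t` an operation of `Mag^{T ⊂ S}`. -/
def relations (R : MagRootAlgebra K T S A) : Set (Mag K S A) :=
  {z | ∃ (t : PTree S) (ht : t.RootNotIn T) (a : t.Leaves → A),
    z = labelled K S A t (PiTensorProduct.tprod K a) -
      labelled K S A .leaf (PiTensorProduct.tprod K fun _ => R.op t ht a)}

/-- The ideal generated by the relations: the smallest subspace that contains them and is stable
under all operations as soon as one of the arguments belongs to it. -/
def ideal (R : MagRootAlgebra K T S A) : Submodule K (Mag K S A) :=
  sInf {J | R.relations ⊆ J ∧
    ∀ (k : ℕ) (hk : k ∈ S) (x : Fin k → Mag K S A) (i : Fin k), x i ∈ J → graft K k hk x ∈ J}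

theorem relations_subset (R : MagRootAlgebra K T S A) : R.relations ⊆ R.ideal := by
  intro z hz
  rw [SetLike.mem_coe, ideal, Submodule.mem_sInf]
  exact fun J hJ => hJ.1 hz

theorem graft_mem_ideal (R : MagRootAlgebra K T S A) (k : ℕ) (hk : k ∈ S) (x : Fin k → Mag K S A)
    (i : Fin k) (hi : x i ∈ R.ideal) : graft K k hk x ∈ R.ideal := by
  rw [ideal, Submodule.mem_sInf] at *
  exact fun J hJ => hJ.2 k hk x i (hi J hJ)

theorem ideal_le_ker (R : MagRootAlgebra K T S A) (k : ℕ) (hk : k ∈ T) :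
    R.ideal ≤ LinearMap.ker
      (PiTensorProduct.map (fun _ : Fin k => R.ideal.mkQ) ∘ₗ ungraft K k) := by
  refine le_trans (sInf_le ⟨?_, ?_⟩) (inf_le_right (a := R.ideal))
  · intro z hz
    refine ⟨R.relations_subset hz, ?_⟩
    obtain ⟨t, ht, a, rfl⟩ := hz
    have h : ungraftTree K k t (PiTensorProduct.tprod K a) = 0 := by
      cases t with
      | leaf => rfl
      | node l hl ts =>
        have hlk : l ≠ k := fun h => ht (h ▸ hk)
        simp [ungraftTree, hlk]
    have h' (b : A) : ungraftTree K k (.leaf : PTree S)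
        (PiTensorProduct.tprod K fun _ => b) = 0 := rfl
    rw [SetLike.mem_coe, LinearMap.mem_ker, LinearMap.comp_apply, map_sub, ungraft_labelled,
      ungraft_labelled, h, h', sub_zero, map_zero]
  · intro l hl x i hi
    refine ⟨R.graft_mem_ideal l hl x i hi.1, ?_⟩
    rw [SetLike.mem_coe, LinearMap.mem_ker, LinearMap.comp_apply]
    by_cases h : l = k
    · subst h
      rw [ungraft_graft_self, PiTensorProduct.map_tprod]
      refine MultilinearMap.map_coord_zero _ i ?_
      rw [← LinearMap.mem_ker, Submodule.ker_mkQ]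
      exact hi.1
    · rw [ungraft_graft_of_ne K k l hl h, map_zero]

open scoped Classical in
/-- The operations induced by grafting. -/
def quotMu (R : MagRootAlgebra K T S A) (k : ℕ) :
    MultilinearMap K (fun _ : Fin k => Mag K S A ⧸ R.ideal) (Mag K S A ⧸ R.ideal) :=
  if hk : k ∈ S then
    quotOp (graft K k hk) R.ideal (fun x i => R.graft_mem_ideal k hk x i)
  else 0

open scoped Classical in
/-- The co-operations induced by ungrafting. -/
def quotComul (R : MagRootAlgebra K T S A) (k : ℕ) :
    (Mag K S A ⧸ R.ideal) →ₗ[K] ⨂[K] _ : Fin k, (Mag K S A ⧸ R.ideal) :=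
  if hk : k ∈ T then
    quotCoop (ungraft K (S := S) (V := A) k) R.ideal fun _ hx =>
      LinearMap.mem_ker.mp (R.ideal_le_ker k hk hx)
  else 0

theorem quotComul_quotMu (R : MagRootAlgebra K T S A) (k : ℕ) (hk : k ∈ T) (l : ℕ) (hl : l ∈ S)
    (x : Fin l → Mag K S A) :
    R.quotComul k (R.quotMu l fun i => R.ideal.mkQ (x i)) =
      PiTensorProduct.map (fun _ : Fin k => R.ideal.mkQ) (ungraft K k (graft K l hl x)) := by
  rw [quotMu, dif_pos hl, quotOp_mkQ, quotComul, dif_pos hk, quotCoop_mkQ]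

/-- The quotient of the free `S`-magmatic algebra on `A` by the relations identifying the operations
of the `Mag^{T ⊂ S}`-algebra `A` with those of the free algebra, as a `(T,S)`-magmatic
bialgebra: the operations are induced by grafting, and the co-operations by ungrafting (so that
the elements of `A` are primitive). -/
def reducedEnv (R : MagRootAlgebra K T S A) : MagBialgebra K T S (Mag K S A ⧸ R.ideal) where
  mu := R.quotMu
  comul := R.quotComul
  comul_mu_self k hk hk' x := by
    obtain ⟨y, rfl⟩ : ∃ y : Fin k → Mag K S A, x = fun i => R.ideal.mkQ (y i) :=
      ⟨fun i => Quotient.out (x i), funext fun i => (Quotient.out_eq (x i)).symm⟩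
    rw [R.quotComul_quotMu k hk k hk', ungraft_graft_self, PiTensorProduct.map_tprod]
  comul_mu_of_ne k hk l hl h x := by
    obtain ⟨y, rfl⟩ : ∃ y : Fin l → Mag K S A, x = fun i => R.ideal.mkQ (y i) :=
      ⟨fun i => Quotient.out (x i), funext fun i => (Quotient.out_eq (x i)).symm⟩
    rw [R.quotComul_quotMu k hk l hl, ungraft_graft_of_ne K k l hl h, map_zero]

/-- The universal enveloping unital `(m,n)`-magmatic bialgebra `U(A)` of a `Mag^{m ⊂ n}`-algebra `A`:
the quotient of the free unital `n`-magmatic algebra `K 1 ⊕ Mag^n(A)` by the relations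
identifying the operations of the `Mag^{m ⊂ n}`-algebra `A` with those of the free algebra. -/
def env {m n : ℕ} (R : MagRootAlgebra K (Set.Icc 2 m) (Set.Icc 2 n) A) :
    UnitalMagBialgebra K m n (K × (Mag K (Set.Icc 2 n) A ⧸ R.ideal)) :=
  R.reducedEnv.adjoinUnit

end MagRootAlgebra

/-- Isomorphism of unital `(m,n)`-magmatic bialgebras. -/
def UnitalMagBialgebra.IsIsomorphic {K : Type v} [Field K] {m n : ℕ} {H H' : Type*}
    [AddCommGroup H] [Module K H] [AddCommGroup H'] [Module K H']
    (B : UnitalMagBialgebra K m n H) (B' : UnitalMagBialgebra K m n H') : Prop :=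
  ∃ f : H ≃ₗ[K] H',
    B.toUnitalMagCoalgebra.IsHom B'.toUnitalMagCoalgebra f.toLinearMap ∧
    ∀ k, 2 ≤ k → k ≤ n → ∀ x : Fin k → H, f (B.mu k x) = B'.mu k fun i => f (x i)

end
end Magmatic

namespace Magmatic

noncomputable section

/-! ### Trees with a bounded number of leaves -/

namespace PTree

variable {m : ℕ}

/-! Everything takes place on the augmentation ideal, the kernel of the counit. There the reduced
co-operations `δ_k` take values in tensors of the augmentation ideal (`map_sub_reduced`), and the
compatibility relation becomes `δ_k μ_k = Id` and `δ_k μ_l = 0` for `l ≠ k` (`reduced_mu`).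
Consequently `π = Id - ∑_{2 ≤ k ≤ m} μ_k δ_k` is a projection onto the primitive part.

Let `C` carry co-operations `δ_k` and let `φ` be a linear map from `C` to the primitive part. A map
`f` into the augmentation ideal commutes with the `δ_k` and satisfies `π f = φ` exactly when `f = φ
+ ∑_k μ_k f^{⊗ k} δ_k` (`isTreeSum_augMu_iff`). Iterating this equation writes `f` as the sum over
planar trees `t` of `μ_t φ^{⊗ leaves} δ_t`. If `C` is conilpotent, only finitely many trees
contribute at each element, so the solution exists and is unique (`exists_isTreeSum`,
`IsTreeSum.unique`). This is the cofreeness of a connected bialgebra; conversely, connectedness is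
part of cofreeness.

For the isomorphism with the enveloping bialgebra, the same equation is solved with values in the
quotient of the free magmatic algebra, starting from `π`. The solution `g` is inverse to the
evaluation `e` of trees: `e g` and the identity solve the same equation, and `g e` is the identity
because the quotient is generated by the primitive elements under the operations of arity at most
`m`, a tree with a root of larger arity being identified with a primitive element
(`eq_top_of_quotMu_mem`, `exists_inverse_envEval`). The same generation property gives the converse:
an element obtained from primitive elements by operations of arity at most `m` is annihilated by all
sufficiently large composites of co-operations (`reducedTree_mu_eq_zero`). -/

theorem numLeaves_pos (t : PTree (Set.Icc 2 m)) : 0 < t.numLeaves := by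
  induction t with
  | leaf => exact Nat.one_pos
  | node k hk ts ih =>
    have : Nonempty (Fin k) := ⟨⟨0, by have := hk.1; omega⟩⟩
    exact Finset.sum_pos (fun i _ => ih i) Finset.univ_nonempty

theorem numLeaves_lt_node {k : ℕ} (hk : k ∈ Set.Icc 2 m) (ts : Fin k → PTree (Set.Icc 2 m))
    (i : Fin k) : (ts i).numLeaves < (node k hk ts).numLeaves := by
  have : Nontrivial (Fin k) := Fin.nontrivial_iff_two_le.mpr hk.1
  obtain ⟨j, hj⟩ := exists_ne i
  exact Finset.single_lt_sum (f := fun j => (ts j).numLeaves) hj (Finset.mem_univ i)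
    (Finset.mem_univ j) (numLeaves_pos _) fun _ _ _ => Nat.zero_le _

open scoped Classical in
/-- The trees of depth at most `r`. -/
def boundedDepth (m : ℕ) : ℕ → Finset (PTree (Set.Icc 2 m))
  | 0 => {leaf}
  | r + 1 => insert leaf <| (Finset.Icc 2 m).attach.biUnion fun k =>
      (Fintype.piFinset fun _ : Fin k.1 => boundedDepth m r).image
        (node k.1 (Finset.mem_Icc.mp k.2))

theorem mem_boundedDepth_node {r k : ℕ} {hk : k ∈ Set.Icc 2 m} {ts : Fin k → PTree (Set.Icc 2 m)} :
    node k hk ts ∈ boundedDepth m (r + 1) ↔ ∀ i, ts i ∈ boundedDepth m r := by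
  simp only [boundedDepth, Finset.mem_insert, Finset.mem_biUnion, Finset.mem_image,
    Fintype.mem_piFinset]
  constructor
  · rintro (h | ⟨k', -, ts', h, h'⟩)
    · cases h
    · cases h'
      exact h
  · exact fun h => Or.inr ⟨⟨k, Finset.mem_Icc.mpr hk⟩, Finset.mem_attach _ _, ts, h, rfl⟩

theorem leaf_mem_boundedDepth (r : ℕ) : leaf ∈ boundedDepth m r := by
  cases r <;> simp [boundedDepth]

theorem boundedDepth_subset_succ (r : ℕ) : boundedDepth m r ⊆ boundedDepth m (r + 1) := by
  intro t ht
  induction t generalizing r with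
  | leaf => exact leaf_mem_boundedDepth _
  | node k hk ts ih =>
    cases r with
    | zero => simp [boundedDepth] at ht
    | succ r =>
      rw [mem_boundedDepth_node] at ht ⊢
      exact fun i => ih i r (ht i)

/-- Inner vertices have arity at least `2`, so a subtree at the root loses at least one leaf; each
level of depth therefore costs a leaf. This turns conilpotency, a bound on leaves, into a bound on
depth. -/
theorem mem_boundedDepth_of_numLeaves_le {r : ℕ} {t : PTree (Set.Icc 2 m)}
    (h : t.numLeaves ≤ r + 1) : t ∈ boundedDepth m r := by
  induction t generalizing r with
  | leaf => exact leaf_mem_boundedDepth r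
  | node k hk ts ih =>
    have hlt := numLeaves_lt_node hk ts
    cases r with
    | zero =>
      have h1 := hlt ⟨0, by have := hk.1; omega⟩
      have h2 := numLeaves_pos (ts ⟨0, by have := hk.1; omega⟩)
      omega
    | succ r =>
      rw [mem_boundedDepth_node]
      exact fun i => ih i (by have := hlt i; omega)

theorem sum_boundedDepth_succ {N : Type*} [AddCommMonoid N] (r : ℕ) (F : PTree (Set.Icc 2 m) → N) :
    ∑ t ∈ boundedDepth m (r + 1), F t = F leaf + ∑ k ∈ (Finset.Icc 2 m).attach,
      ∑ ts ∈ Fintype.piFinset fun _ : Fin k.1 => boundedDepth m r,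
        F (node k.1 (Finset.mem_Icc.mp k.2) ts) := by
  classical
  rw [boundedDepth, Finset.sum_insert (by simp), Finset.sum_biUnion]
  · congr 1
    refine Finset.sum_congr rfl fun k _ => ?_
    rw [Finset.sum_image fun ts _ ts' _ h => by cases h; rfl]
  · intro k _ k' _ hkk'
    rw [Function.onFun, Finset.disjoint_left]
    intro t ht ht'
    obtain ⟨ts, -, rfl⟩ := Finset.mem_image.mp ht
    obtain ⟨ts', -, h⟩ := Finset.mem_image.mp ht'
    injection h with h
    exact hkk' (Subtype.ext h.symm)

end PTree

/-! ### Composites of co-operations along trees -/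

section CoTree

variable {K : Type v} [Field K] {m : ℕ} {M A : Type*} [AddCommGroup M] [Module K M]
  [AddCommGroup A] [Module K A]

/-- The composite of co-operations along a tree. -/
def coTree (δ : (k : ℕ) → M →ₗ[K] ⨂[K] _ : Fin k, M) :
    (t : PTree (Set.Icc 2 m)) → M →ₗ[K] ⨂[K] _ : t.Leaves, M
  | .leaf => (PiTensorProduct.subsingletonEquiv (R := K) (s := fun _ : Unit => M) ()).symm.toLinearMap
  | .node k hk ts =>
    PiTensorProduct.lift ((treeConcat K hk ts).compLinearMap fun i => coTree δ (ts i)) ∘ₗ δ k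

/-- Composites are also needed for co-operations that live on the augmentation ideal only and are
not those of a unital coalgebra, hence the general form `coTree`. -/
theorem reducedTree_eq_coTree (D : UnitalMagCoalgebra K m M) (t : PTree (Set.Icc 2 m)) :
    D.reducedTree t = coTree D.reduced t := by
  induction t with
  | leaf => rfl
  | node k hk ts ih => simp only [UnitalMagCoalgebra.reducedTree, coTree, ih]

theorem coTree_leaf (δ : (k : ℕ) → M →ₗ[K] ⨂[K] _ : Fin k, M) (x : M) :
    coTree (m := m) δ .leaf x = PiTensorProduct.tprod K fun _ => x :=
  PiTensorProduct.subsingletonEquiv_symm_apply' (R := K) (M := M) () x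

theorem map_coTree (δ : (k : ℕ) → M →ₗ[K] ⨂[K] _ : Fin k, M)
    (δ' : (k : ℕ) → A →ₗ[K] ⨂[K] _ : Fin k, A) (f : M →ₗ[K] A)
    (hf : ∀ k ∈ Set.Icc 2 m, ∀ x, δ' k (f x) = PiTensorProduct.map (fun _ => f) (δ k x))
    (t : PTree (Set.Icc 2 m)) (x : M) :
    coTree δ' t (f x) = PiTensorProduct.map (fun _ => f) (coTree δ t x) := by
  induction t generalizing x with
  | leaf =>
    rw [coTree_leaf, coTree_leaf]
    exact (PiTensorProduct.map_tprod (s := fun _ : Unit => M) (t := fun _ : Unit => A) _ _).symm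
  | node k hk ts ih =>
    rw [coTree, coTree, LinearMap.comp_apply, LinearMap.comp_apply, hf k hk]
    induction δ k x using PiTensorProduct.induction_on with
    | add y z hy hz => simp only [map_add, hy, hz]
    | smul_tprod r v =>
      simp only [map_smul, PiTensorProduct.map_tprod, PiTensorProduct.lift.tprod,
        MultilinearMap.compLinearMap_apply, ih]
      congr 1
      -- Applying `f` to all factors commutes with concatenation; both sides are multilinear, so
      -- pure tensors suffice.
      have : (treeConcat K hk ts).compLinearMap (fun i => PiTensorProduct.map
            (fun _ : (ts i).Leaves => f)) =
          (PiTensorProduct.map (fun _ : (PTree.node k hk ts).Leaves => f)).compMultilinearMap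
            (treeConcat K hk ts) := by
        refine MultilinearMap.ext_of_span_eq_top (g := fun i => fun v : (ts i).Leaves → M =>
          PiTensorProduct.tprod K v) (fun i => PiTensorProduct.span_tprod_eq_top) fun v => ?_
        simp only [MultilinearMap.compLinearMap_apply, PiTensorProduct.map_tprod,
          LinearMap.compMultilinearMap_apply]
        rw [treeConcat_tprod, treeConcat_tprod, PiTensorProduct.map_tprod]
      exact congrArg (fun F => F fun i => coTree δ (ts i) (v i)) this

/-- Conilpotency: every element is annihilated by all composites of co-operations with sufficiently
many outputs. -/
def IsConilpotent (m : ℕ) (δ : (k : ℕ) → M →ₗ[K] ⨂[K] _ : Fin k, M) : Prop :=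
  ∀ x, ∃ r, ∀ t : PTree (Set.Icc 2 m), r < t.numLeaves → coTree δ t x = 0

/-! ### Sums over trees -/

variable (mu : (k : ℕ) → MultilinearMap K (fun _ : Fin k => A) A)
  (δ : (k : ℕ) → M →ₗ[K] ⨂[K] _ : Fin k, M)

/-- The map `f` is the sum over all trees `t` of the operation `t` composed with `φ` on the leaves and
with the co-operation `t`, in the form of a fixed point equation. -/
def IsTreeSum (m : ℕ) (φ f : M →ₗ[K] A) : Prop :=
  ∀ x, f x = φ x + ∑ k ∈ Finset.Icc 2 m,
    PiTensorProduct.lift (mu k) (PiTensorProduct.map (fun _ => f) (δ k x))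

/-- The iterates of the operator of which the tree sums are the fixed points. -/
def treeSumIter (m : ℕ) (φ ψ : M →ₗ[K] A) : ℕ → M →ₗ[K] A
  | 0 => ψ
  | r + 1 => φ + ∑ k ∈ Finset.Icc 2 m,
    PiTensorProduct.lift (mu k) ∘ₗ PiTensorProduct.map (fun _ => treeSumIter m φ ψ r) ∘ₗ δ k

/-- The contribution of a tree to `treeSumIter`. -/
def treeTerm (φ ψ : M →ₗ[K] A) : PTree (Set.Icc 2 m) → ℕ → M →ₗ[K] A
  | .leaf, 0 => ψ
  | .node _ _ _, 0 => 0
  | .leaf, _ + 1 => φ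
  | .node k _ ts, r + 1 =>
    PiTensorProduct.lift (mu k) ∘ₗ PiTensorProduct.map (fun i => treeTerm φ ψ (ts i) r) ∘ₗ δ k

/-- Expanding `μ_k` of `k` sums over trees by multilinearity amounts to choosing one tree for each
input, that is, a tree one level deeper whose root has arity `k`. -/
theorem treeSumIter_eq_sum (φ ψ : M →ₗ[K] A) (r : ℕ) (x : M) :
    treeSumIter mu δ m φ ψ r x = ∑ t ∈ PTree.boundedDepth m r, treeTerm mu δ φ ψ t r x := by
  induction r generalizing x with
  | zero => simp [PTree.boundedDepth, treeSumIter, treeTerm]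
  | succ r ih =>
    have ih' : treeSumIter mu δ m φ ψ r =
        ∑ t ∈ PTree.boundedDepth m r, treeTerm mu δ φ ψ t r := by
      ext x
      simp [ih]
    rw [PTree.sum_boundedDepth_succ]
    simp only [treeSumIter, treeTerm, LinearMap.add_apply, LinearMap.sum_apply,
      LinearMap.comp_apply]
    congr 1
    rw [← Finset.sum_attach]
    refine Finset.sum_congr rfl fun k _ => ?_
    rw [ih']
    induction δ k.1 x using PiTensorProduct.induction_on with
    | add y z hy hz => simp only [map_add, hy, hz, Finset.sum_add_distrib]
    | smul_tprod c v =>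
      simp only [map_smul, PiTensorProduct.map_tprod, PiTensorProduct.lift.tprod,
        LinearMap.sum_apply, ← Finset.smul_sum]
      congr 1
      exact MultilinearMap.map_sum_finset (mu k.1) (fun i t => treeTerm mu δ φ ψ t r (v i))
        fun _ => PTree.boundedDepth m r

/-- The co-operations in the contribution of a tree can all be performed before the operations and
the maps `φ`, `ψ`. Only the factorization matters: the contribution vanishes wherever the composite
of co-operations does. -/
theorem exists_treeTerm_eq (φ ψ : M →ₗ[K] A) (t : PTree (Set.Icc 2 m)) (r : ℕ) :
    ∃ h : (⨂[K] _ : t.Leaves, M) →ₗ[K] A, treeTerm mu δ φ ψ t r = h ∘ₗ coTree δ t := by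
  induction t generalizing r with
  | leaf =>
    have key (f : M →ₗ[K] A) : f = (f ∘ₗ (PiTensorProduct.subsingletonEquiv (R := K)
        (s := fun _ : Unit => M) ()).toLinearMap) ∘ₗ coTree (m := m) δ .leaf := by
      ext x
      simp [coTree]
    cases r with
    | zero => exact ⟨_, key ψ⟩
    | succ r => exact ⟨_, key φ⟩
  | node k hk ts ih =>
    cases r with
    | zero => exact ⟨0, by simp [treeTerm]⟩
    | succ r =>
      choose h hh using fun i => ih i r
      let F : MultilinearMap K (fun _ : (PTree.node k hk ts).Leaves => M) A :=
        (mu k).compMultilinearMap fun i => (h i).compMultilinearMap (PiTensorProduct.tprod K)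
      have hF : (PiTensorProduct.lift F).compMultilinearMap (treeConcat K hk ts) =
          (mu k).compLinearMap h := by
        refine MultilinearMap.ext_of_span_eq_top (g := fun i => fun v : (ts i).Leaves → M =>
          PiTensorProduct.tprod K v) (fun i => PiTensorProduct.span_tprod_eq_top) fun v => ?_
        simp only [MultilinearMap.compLinearMap_apply, LinearMap.compMultilinearMap_apply]
        rw [treeConcat_tprod, PiTensorProduct.lift.tprod]
        rfl
      refine ⟨PiTensorProduct.lift F, LinearMap.ext fun x => ?_⟩
      simp only [treeTerm, coTree, LinearMap.comp_apply]
      induction δ k x using PiTensorProduct.induction_on with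
      | add y z hy hz => simp only [map_add, hy, hz]
      | smul_tprod c v =>
        simp only [map_smul, PiTensorProduct.map_tprod, PiTensorProduct.lift.tprod,
          MultilinearMap.compLinearMap_apply, hh]
        congr 1
        exact (congrArg (fun G => G fun i => coTree δ (ts i) (v i)) hF).symm

theorem treeTerm_eq_zero (φ ψ : M →ₗ[K] A) {t : PTree (Set.Icc 2 m)} (r : ℕ) {x : M}
    (h : coTree δ t x = 0) : treeTerm mu δ φ ψ t r x = 0 := by
  obtain ⟨g, hg⟩ := exists_treeTerm_eq mu δ φ ψ t r
  rw [hg, LinearMap.comp_apply, h, map_zero]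

/-- The initial value `ψ` enters only at leaves of depth exactly `r`. A tree with at most `r` leaves
has depth less than `r`, so neither `ψ` nor a further iteration affects its contribution. -/
theorem treeTerm_succ (φ ψ ψ' : M →ₗ[K] A) {t : PTree (Set.Icc 2 m)} {r : ℕ}
    (h : t.numLeaves ≤ r) : treeTerm mu δ φ ψ t (r + 1) = treeTerm mu δ φ ψ' t r := by
  induction t generalizing r with
  | leaf =>
    obtain ⟨r, rfl⟩ := Nat.exists_eq_succ_of_ne_zero (Nat.one_le_iff_ne_zero.mp h)
    rfl
  | node k hk ts ih =>
    have hpos := PTree.numLeaves_pos (.node k hk ts)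
    obtain ⟨r, rfl⟩ : ∃ s, r = s + 1 := ⟨r - 1, by omega⟩
    have (i : Fin k) : treeTerm mu δ φ ψ (ts i) (r + 1) = treeTerm mu δ φ ψ' (ts i) r :=
      ih i (by have := PTree.numLeaves_lt_node hk ts i; omega)
    rw [treeTerm, treeTerm]
    simp only [this]

/-- Trees with more than `R` leaves contribute nothing at `x`, and the others have contributions
independent of the initial value and of `r`. Allowing two initial values makes this serve both
purposes: stabilization of the iterates (existence) and comparison of two fixed points (uniqueness).
-/
theorem treeSumIter_succ_eq (φ ψ ψ' : M →ₗ[K] A) {x : M} {R r : ℕ} (hr : R ≤ r)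
    (hx : ∀ t : PTree (Set.Icc 2 m), R < t.numLeaves → coTree δ t x = 0) :
    treeSumIter mu δ m φ ψ (r + 1) x = treeSumIter mu δ m φ ψ' r x := by
  classical
  rw [treeSumIter_eq_sum, treeSumIter_eq_sum]
  symm
  refine Finset.sum_subset_zero_on_sdiff (PTree.boundedDepth_subset_succ r) ?_ ?_
  · intro t ht
    refine treeTerm_eq_zero _ _ _ _ _ (hx t ?_)
    by_contra h
    exact (Finset.mem_sdiff.mp ht).2 (PTree.mem_boundedDepth_of_numLeaves_le (by omega))
  · intro t _
    by_cases h : t.numLeaves ≤ r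
    · rw [treeTerm_succ mu δ φ ψ ψ' h]
    · rw [treeTerm_eq_zero _ _ _ _ _ (hx t (by omega)),
        treeTerm_eq_zero _ _ _ _ _ (hx t (by omega))]

variable {mu δ}

theorem IsTreeSum.treeSumIter_eq {φ f : M →ₗ[K] A} (hf : IsTreeSum mu δ m φ f) (r : ℕ) :
    treeSumIter mu δ m φ f r = f := by
  induction r with
  | zero => rfl
  | succ r ih =>
    ext x
    rw [hf x, treeSumIter, ih]
    simp

theorem IsTreeSum.unique (hδ : IsConilpotent m δ) {φ f f' : M →ₗ[K] A}
    (hf : IsTreeSum mu δ m φ f) (hf' : IsTreeSum mu δ m φ f') : f = f' := by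
  ext x
  obtain ⟨R, hR⟩ := hδ x
  have := treeSumIter_succ_eq mu δ φ f f' le_rfl hR
  rwa [hf.treeSumIter_eq, hf'.treeSumIter_eq] at this

theorem exists_isTreeSum (mu : (k : ℕ) → MultilinearMap K (fun _ : Fin k => A) A)
    (hδ : IsConilpotent m δ) (φ : M →ₗ[K] A) : ∃ f, IsTreeSum mu δ m φ f := by
  -- At each element the iterates are eventually constant; the solution is their pointwise limit.
  -- Its linearity follows by choosing one index at which all the elements involved have stabilized.
  have h1 (x : M) : ∃ y, ∀ᶠ r in Filter.atTop, treeSumIter mu δ m φ 0 r x = y := by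
    obtain ⟨R, hR⟩ := hδ x
    refine ⟨treeSumIter mu δ m φ 0 R x, Filter.eventually_atTop.mpr ⟨R, fun r hr => ?_⟩⟩
    induction r, hr using Nat.le_induction with
    | base => rfl
    | succ r hr ih => rw [treeSumIter_succ_eq mu δ φ 0 0 hr hR, ih]
  choose F hF using h1
  let f : M →ₗ[K] A :=
    { toFun := F
      map_add' := fun x y => by
        obtain ⟨r, h, h', h''⟩ := ((hF (x + y)).and ((hF x).and (hF y))).exists
        rw [← h, ← h', ← h'', map_add]
      map_smul' := fun c x => by
        obtain ⟨r, h, h'⟩ := ((hF (c • x)).and (hF x)).exists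
        rw [← h, ← h', map_smul, RingHom.id_apply] }
  -- A tensor is a finite sum of pure tensors, hence involves finitely many elements, and the
  -- iterates have stabilized on all of them from some index on.
  have h2 (k : ℕ) (w : ⨂[K] _ : Fin k, M) : ∀ᶠ r in Filter.atTop,
      PiTensorProduct.map (fun _ => treeSumIter mu δ m φ 0 r) w =
        PiTensorProduct.map (fun _ => f) w := by
    induction w using PiTensorProduct.induction_on with
    | add y z hy hz =>
      filter_upwards [hy, hz] with r h h'
      rw [map_add, map_add, h, h']
    | smul_tprod c v =>
      filter_upwards [Filter.eventually_all.mpr fun i => hF (v i)] with r h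
      rw [map_smul, map_smul, PiTensorProduct.map_tprod, PiTensorProduct.map_tprod]
      simp only [h]
      rfl
  refine ⟨f, fun x => ?_⟩
  have h3 : ∀ᶠ r in Filter.atTop, ∀ k ∈ Finset.Icc 2 m,
      PiTensorProduct.map (fun _ => treeSumIter mu δ m φ 0 r) (δ k x) =
        PiTensorProduct.map (fun _ => f) (δ k x) :=
    (Filter.eventually_all_finset _).mpr fun k _ => h2 k _
  -- At a suitable index `r`, the iterate `r + 1` agrees with the limit at `x` and the iterate `r`
  -- agrees with it inside all the tensors `δ_k x`; the recursion becomes the fixed point equation.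
  obtain ⟨r, h, h'⟩ := (((Filter.tendsto_add_atTop_nat 1).eventually (hF x)).and h3).exists
  have : f x = F x := rfl
  rw [this, ← h, treeSumIter, LinearMap.add_apply, LinearMap.sum_apply]
  congr 1
  refine Finset.sum_congr rfl fun k hk => ?_
  rw [LinearMap.comp_apply, LinearMap.comp_apply, h' k hk]

/-- A tree sum is a morphism of coalgebras if the co-operations of its target are left inverse to the
operations and vanish on the image of `φ`. -/
theorem IsTreeSum.comul_apply {φ f : M →ₗ[K] A} (hf : IsTreeSum mu δ m φ f)
    {δ' : (k : ℕ) → A →ₗ[K] ⨂[K] _ : Fin k, A}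
    (hself : ∀ k ∈ Set.Icc 2 m, ∀ x, δ' k (mu k x) = PiTensorProduct.tprod K x)
    (hne : ∀ k ∈ Set.Icc 2 m, ∀ l ∈ Set.Icc 2 m, l ≠ k → ∀ x, δ' k (mu l x) = 0)
    (hφ : ∀ k ∈ Set.Icc 2 m, ∀ x, δ' k (φ x) = 0) {k : ℕ} (hk : k ∈ Set.Icc 2 m) (x : M) :
    δ' k (f x) = PiTensorProduct.map (fun _ => f) (δ k x) := by
  have h1 (l : ℕ) (hl : l ∈ Set.Icc 2 m) (h : l ≠ k) :
      δ' k ∘ₗ PiTensorProduct.lift (mu l) = 0 := by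
    ext v
    simpa using hne k hk l hl h v
  have h2 : δ' k ∘ₗ PiTensorProduct.lift (mu k) = LinearMap.id := by
    ext v
    simpa using hself k hk v
  rw [hf x, map_add, hφ k hk, zero_add, map_sum, Finset.sum_eq_single k]
  · exact LinearMap.congr_fun h2 _
  · intro l hl h
    exact LinearMap.congr_fun (h1 l (Finset.mem_Icc.mp hl) h) _
  · exact fun h => absurd (Finset.mem_Icc.mpr hk) h

end CoTree

/-! ### The augmentation ideal of a unital magmatic coalgebra -/

section Contract

variable {K : Type v} [Field K] {A : Type*} [AddCommGroup A] [Module K A]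

theorem map_ins {A' : Type*} [AddCommGroup A'] [Module K A'] (f : A →ₗ[K] A') (o : A) {j k : ℕ}
    (e : Fin j ↪o Fin k) (w : ⨂[K] _ : Fin j, A) :
    PiTensorProduct.map (fun _ => f) (ins K o e w) =
      ins K (f o) e (PiTensorProduct.map (fun _ => f) w) := by
  induction w using PiTensorProduct.induction_on with
  | add y z hy hz => simp only [map_add, hy, hz]
  | smul_tprod c v =>
    simp only [map_smul, ins_tprod, PiTensorProduct.map_tprod]
    congr 2
    funext b
    exact Function.apply_extend f _ _ b

theorem map_map_apply {ι A' A'' : Type*} [AddCommGroup A'] [Module K A'] [AddCommGroup A'']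
    [Module K A''] (f : A →ₗ[K] A') (g : A' →ₗ[K] A'') (w : ⨂[K] _ : ι, A) :
    PiTensorProduct.map (fun _ => g) (PiTensorProduct.map (fun _ => f) w) =
      PiTensorProduct.map (fun _ => g ∘ₗ f) w := by
  rw [PiTensorProduct.map_comp, LinearMap.comp_apply]

theorem ins_refl (o : A) {k : ℕ} (w : ⨂[K] _ : Fin k, A) :
    ins K o (RelEmbedding.refl _) w = w := by
  induction w using PiTensorProduct.induction_on with
  | add y z hy hz => simp only [map_add, hy, hz]
  | smul_tprod c v =>
    rw [map_smul, ins_tprod]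
    congr 2
    exact Function.extend_id _ _

theorem contract_ins_of_avoid (ε : A →ₗ[K] K) {o : A} (ho : ε o = 1) {j k : ℕ} (i : Fin (k + 1))
    (e : Fin j ↪o Fin k) (w : ⨂[K] _ : Fin j, A) :
    contract ε i (ins K o (e.trans (Fin.succAboveOrderEmb i)) w) = ins K o e w := by
  induction w using PiTensorProduct.induction_on with
  | add y z hy hz => simp only [map_add, hy, hz]
  | smul_tprod c v =>
    have h1 : Function.extend (fun a => i.succAbove (e a)) v (fun _ => o) i = o :=
      Function.extend_apply' _ _ _ (by
        rintro ⟨a, ha⟩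
        exact Fin.succAbove_ne i _ ha)
    have h2 (b : Fin k) := extend_comp_apply (f := e) (Fin.succAbove_right_injective (p := i)) v o b
    have h3 : ((e.trans (Fin.succAboveOrderEmb i) : Fin j ↪o Fin (k + 1)) : Fin j → Fin (k + 1)) =
        fun a => i.succAbove (e a) := rfl
    rw [map_smul, map_smul, map_smul, ins_tprod, ins_tprod, contract_tprod, h3, h1]
    simp only [h2, ho, one_smul]

theorem contract_ins_of_mem (ε : A →ₗ[K] K) (o : A) {p : A →ₗ[K] A} (hp : ∀ x, ε (p x) = 0)
    {j k : ℕ} (i : Fin (k + 1)) (e : Fin j ↪o Fin (k + 1)) (he : ∃ a, e a = i)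
    (w : ⨂[K] _ : Fin j, A) :
    contract ε i (ins K o e (PiTensorProduct.map (fun _ => p) w)) = 0 := by
  obtain ⟨a, rfl⟩ := he
  induction w using PiTensorProduct.induction_on with
  | add y z hy hz => simp only [map_add, hy, hz, add_zero]
  | smul_tprod c v =>
    simp [ins_tprod, contract_tprod, PiTensorProduct.map_tprod, e.injective.extend_apply, hp]

/-- In the slot `i`, subtracting `ε(v_i) o` from `v_i` is the same as removing the factor `v_i` with
coefficient `ε(v_i)` and putting `o` back in its place. -/
theorem map_update_sub_smulRight (ε : A →ₗ[K] K) (o : A) {k : ℕ} (i : Fin (k + 1))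
    (w : ⨂[K] _ : Fin (k + 1), A) :
    PiTensorProduct.map
        (Function.update (fun _ => LinearMap.id) i (LinearMap.id - ε.smulRight o)) w =
      w - ins K o (Fin.succAboveOrderEmb i) (contract ε i w) := by
  induction w using PiTensorProduct.induction_on with
  | add y z hy hz => simp only [map_add, hy, hz]; abel
  | smul_tprod c v =>
    have h1 : (fun j => Function.update (fun _ => LinearMap.id) i (LinearMap.id - ε.smulRight o) j
        (v j)) = Function.update v i (v i - ε (v i) • o) := by
      funext j
      by_cases h : j = i
      · subst h; simp
      · simp [h]
    have h2 : Function.extend (Fin.succAboveOrderEmb i) (fun a => v (i.succAbove a)) (fun _ => o) =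
        Function.update v i o := by
      funext j
      induction j using i.succAboveCases with
      | x =>
        rw [Function.update_self, Function.extend_apply']
        rintro ⟨a, ha⟩
        exact Fin.succAbove_ne i _ ha
      | p a =>
        rw [Function.update_of_ne (Fin.succAbove_ne i a)]
        exact (Fin.succAboveOrderEmb i).injective.extend_apply _ _ a
    rw [map_smul, map_smul, map_smul, PiTensorProduct.map_tprod, contract_tprod, map_smul,
      ins_tprod, h1, h2, MultilinearMap.map_update_sub, MultilinearMap.map_update_smul, smul_sub,
      Function.update_eq_self]

/-- By the preceding formula, projecting a single slot does not change a tensor whose contractions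
all vanish. The slots are treated one after the other. When `ε o = 1`, this says that such a tensor
comes from the tensor power of the kernel of `ε`. -/
theorem map_sub_smulRight_of_contract_eq_zero (ε : A →ₗ[K] K) (o : A) {k : ℕ}
    {w : ⨂[K] _ : Fin (k + 1), A} (hw : ∀ i, contract ε i w = 0) :
    PiTensorProduct.map (fun _ => LinearMap.id - ε.smulRight o) w = w := by
  have key : ∀ s : Finset (Fin (k + 1)), PiTensorProduct.map
      (fun i => if i ∈ s then LinearMap.id - ε.smulRight o else LinearMap.id) w = w := by
    intro s
    induction s using Finset.induction_on with
    | empty => simp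
    | insert a s ha ih =>
      have h : (fun i => if i ∈ insert a s then LinearMap.id - ε.smulRight o else LinearMap.id) =
          fun i => (if i ∈ s then LinearMap.id - ε.smulRight o else LinearMap.id) ∘ₗ
            Function.update (fun _ => LinearMap.id) a (LinearMap.id - ε.smulRight o) i := by
        funext i
        by_cases hi : i = a
        · subst hi; simp [ha]
        · simp [hi]
      rw [h, PiTensorProduct.map_comp, LinearMap.comp_apply, map_update_sub_smulRight, hw,
        map_zero, sub_zero, ih]
  simpa using key Finset.univ

end Contract

/-! ### Reduced co-operations on the kernel of the counit -/

namespace UnitalMagCoalgebra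

variable {K : Type v} [Field K] {m : ℕ} {C : Type*} [AddCommGroup C] [Module K C]

theorem reduced_zero_apply (D : UnitalMagCoalgebra K m C) (x : C) : D.reduced 0 x = 0 := by
  simp [reduced]

theorem comul_eq_sum_reduced (D : UnitalMagCoalgebra K m C) {k : ℕ} (hk : 1 ≤ k) (x : C) :
    D.comul k x = ∑ j ∈ Finset.range (k + 1), ∑ e : Fin j ↪o Fin k,
      ins K D.one e (D.reduced j x) := by
  obtain ⟨k, rfl⟩ := Nat.exists_eq_add_of_le' hk
  rw [Finset.sum_range_succ, sum_orderEmb_self, ins_refl, UnitalMagBialgebra.reduced_succ_apply]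
  abel

/-- The shuffle expansion is triangular: its top term `j = k` has the single embedding `Id`, so the
expansion determines the family inductively. This is how reduced co-operations are computed below:
it suffices to guess a family and to recognize its shuffle expansion in `Δ_k`. -/
theorem reduced_eq_of_comul_eq_sum (D : UnitalMagCoalgebra K m C) {x : C}
    (w : (j : ℕ) → ⨂[K] _ : Fin j, C) (h0 : w 0 = 0) (h1 : w 1 = PiTensorProduct.tprod K fun _ => x)
    (h : ∀ k, 2 ≤ k → k ≤ m → D.comul k x = ∑ j ∈ Finset.range (k + 1), ∑ e : Fin j ↪o Fin k,
      ins K D.one e (w j)) {k : ℕ} (hk : k ≤ m) : D.reduced k x = w k := by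
  induction k using Nat.strong_induction_on with
  | _ k ih =>
    match k, ih, hk with
    | 0, _, _ => rw [h0, reduced_zero_apply]
    | 1, _, _ => rw [h1, UnitalMagBialgebra.reduced_one]
    | k + 2, ih, hk =>
      rw [UnitalMagBialgebra.reduced_succ_apply, h (k + 2) (by omega) hk, Finset.sum_range_succ,
        sum_orderEmb_self, ins_refl, Finset.sum_congr rfl fun j hj => by
          rw [← ih j (Finset.mem_range.mp hj) ((Finset.mem_range.mp hj).le.trans hk)]]
      abel

/-- The projection on the kernel of the counit. -/
def proj (D : UnitalMagCoalgebra K m C) : C →ₗ[K] LinearMap.ker D.counit :=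
  (LinearMap.id - D.counit.smulRight D.one).codRestrict _ fun x => by simp [D.counit_unit]

theorem coe_proj (D : UnitalMagCoalgebra K m C) (x : C) :
    (D.proj x : C) = x - D.counit x • D.one := rfl

theorem proj_coe (D : UnitalMagCoalgebra K m C) (x : LinearMap.ker D.counit) :
    D.proj x = x := Subtype.ext (by rw [coe_proj, x.2, zero_smul, sub_zero])

theorem proj_one (D : UnitalMagCoalgebra K m C) : D.proj D.one = 0 :=
  Subtype.ext (by rw [coe_proj, D.counit_unit, one_smul, sub_self]; rfl)

theorem counit_smul_add_proj (D : UnitalMagCoalgebra K m C) (x : C) :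
    D.counit x • D.one + (D.proj x : C) = x := by
  rw [coe_proj]; abel

theorem proj_comp_subtype (D : UnitalMagCoalgebra K m C) :
    D.proj ∘ₗ (LinearMap.ker D.counit).subtype = LinearMap.id :=
  LinearMap.ext D.proj_coe

theorem map_proj_map_subtype (D : UnitalMagCoalgebra K m C) {ι : Type*}
    (w : ⨂[K] _ : ι, LinearMap.ker D.counit) :
    PiTensorProduct.map (fun _ => D.proj)
      (PiTensorProduct.map (fun _ => (LinearMap.ker D.counit).subtype) w) = w := by
  rw [map_map_apply, D.proj_comp_subtype,
    PiTensorProduct.map_id, LinearMap.id_apply]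

/-- The reduced co-operations as co-operations of the kernel of the counit. -/
def augReduced (D : UnitalMagCoalgebra K m C) (k : ℕ) :
    LinearMap.ker D.counit →ₗ[K] ⨂[K] _ : Fin k, LinearMap.ker D.counit :=
  PiTensorProduct.map (fun _ => D.proj) ∘ₗ D.reduced k ∘ₗ (LinearMap.ker D.counit).subtype

/-- All contractions of `δ_k(x)` vanish. Contracting `Δ_k(x)` in the slot `i` gives `Δ_{k-1}(x)`;
among the subtracted shuffles, those with a unit in the slot `i` contract to the shuffle expansion
of `Δ_{k-1}(x)`, and the others vanish, since by induction a factor in the kernel of the counit is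
contracted. -/
theorem map_sub_reduced (D : UnitalMagCoalgebra K m C) {x : C} (hx : D.counit x = 0) {k : ℕ}
    (hk : k ≤ m) :
    PiTensorProduct.map (fun _ => LinearMap.id - D.counit.smulRight D.one) (D.reduced k x) =
      D.reduced k x := by
  induction k using Nat.strong_induction_on with
  | _ k ih =>
    match k, ih, hk with
    | 0, _, _ => rw [reduced_zero_apply, map_zero]
    | 1, _, _ => simp [UnitalMagBialgebra.reduced_one, PiTensorProduct.map_tprod, hx]
    | k + 2, ih, hk =>
      refine map_sub_smulRight_of_contract_eq_zero _ _ fun i => ?_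
      rw [UnitalMagBialgebra.reduced_succ_apply, map_sub, D.comul_counit _ (by omega) hk, map_sum,
        D.comul_eq_sum_reduced (by omega), sub_eq_zero]
      refine Finset.sum_congr rfl fun j hj => ?_
      have hj' := Finset.mem_range.mp hj
      rw [map_sum, sum_avoid i]
      · exact Finset.sum_congr rfl fun e _ => (contract_ins_of_avoid _ D.counit_unit i e _).symm
      · intro e he
        rw [← ih j hj' (hj'.le.trans hk)]
        exact contract_ins_of_mem _ _ (by simp [D.counit_unit]) i e he _

theorem map_subtype_augReduced (D : UnitalMagCoalgebra K m C) {k : ℕ} (hk : k ≤ m)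
    (x : LinearMap.ker D.counit) :
    PiTensorProduct.map (fun _ => (LinearMap.ker D.counit).subtype) (D.augReduced k x) =
      D.reduced k x := by
  rw [augReduced, LinearMap.comp_apply, map_map_apply]
  exact D.map_sub_reduced x.2 hk

theorem IsConnected.isConilpotent {D : UnitalMagCoalgebra K m C} (hD : D.IsConnected) :
    IsConilpotent m D.augReduced := by
  intro x
  obtain ⟨r, hr⟩ := hD x
  refine ⟨r, fun t ht => ?_⟩
  obtain ⟨y, hy, z, hz, hyz⟩ := Submodule.mem_sup.mp hr
  obtain ⟨c, rfl⟩ := Submodule.mem_span_singleton.mp hy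
  have hz' := Submodule.mem_inf.mp hz
  -- The counit detects the component along the unit, and it vanishes at `x`.
  have hc : c = 0 := by
    have h := congrArg D.counit hyz
    rw [map_add, map_smul, D.counit_unit, LinearMap.mem_ker.mp hz'.1,
      LinearMap.mem_ker.mp x.2] at h
    simpa using h
  have hx : (x : C) = z := by rw [← hyz, hc, zero_smul, zero_add]
  have h := hz'.2
  simp only [Submodule.mem_iInf, LinearMap.mem_ker] at h
  have h' := h t ht
  rw [← hx, reducedTree_eq_coTree] at h'
  -- The inclusion of the kernel intertwines the two families of co-operations and has a left
  -- inverse on tensors, so vanishing can be tested in `C`.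
  rw [← D.map_proj_map_subtype (coTree D.augReduced t x), ← map_coTree D.augReduced D.reduced,
    Submodule.subtype_apply, h', map_zero]
  exact fun k hk x => (D.map_subtype_augReduced hk.2 x).symm

theorem isConnected_of_reducedTree (D : UnitalMagCoalgebra K m C)
    (h : ∀ x, D.counit x = 0 → ∃ r, ∀ t : PTree (Set.Icc 2 m), r < t.numLeaves →
      D.reducedTree t x = 0) : D.IsConnected := by
  intro x
  obtain ⟨r, hr⟩ := h _ (D.proj x).2
  refine ⟨r, ?_⟩
  rw [← D.counit_smul_add_proj x]
  refine Submodule.add_mem_sup (Submodule.smul_mem _ _ (Submodule.mem_span_singleton_self _)) ?_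
  refine Submodule.mem_inf.mpr ⟨(D.proj x).2, ?_⟩
  simpa only [Submodule.mem_iInf, LinearMap.mem_ker] using hr

/-! ### Coalgebra morphisms in terms of reduced co-operations -/

section Hom

variable {C' : Type*} [AddCommGroup C'] [Module K C'] {D : UnitalMagCoalgebra K m C}
  {D' : UnitalMagCoalgebra K m C'}

/-- The images of the `δ_j(x)` have the shuffle expansion of `Δ_k(f x)`, since `f` preserves the
inserted units; uniqueness of the expansion concludes. -/
theorem IsHom.reduced_apply {f : C →ₗ[K] C'} (hf : D.IsHom D' f) {k : ℕ} (hk : k ≤ m) (x : C) :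
    D'.reduced k (f x) = PiTensorProduct.map (fun _ => f) (D.reduced k x) := by
  refine D'.reduced_eq_of_comul_eq_sum
    (fun j => PiTensorProduct.map (fun _ => f) (D.reduced j x))
    (by rw [reduced_zero_apply, map_zero]) ?_ ?_ hk
  · rw [UnitalMagBialgebra.reduced_one, PiTensorProduct.map_tprod]
  · intro k h2 hk
    rw [hf.map_comul k h2 hk, D.comul_eq_sum_reduced (by omega)]
    simp only [map_sum, map_ins, hf.map_unit]

/-- On the kernel of the counit, `Δ_k` is recovered from the `δ_j` with `j ≤ k` by inserting units,
and the remaining direction is spanned by the unit. -/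
theorem isHom_of_reduced {f : C →ₗ[K] C'} (h1 : f D.one = D'.one)
    (hε : ∀ x, D'.counit (f x) = D.counit x)
    (h : ∀ x, D.counit x = 0 → ∀ k, 2 ≤ k → k ≤ m →
      D'.reduced k (f x) = PiTensorProduct.map (fun _ => f) (D.reduced k x)) : D.IsHom D' f where
  map_unit := h1
  map_counit := hε
  map_comul k h2 hk x := by
    have h' (x : C) (hx : D.counit x = 0) :
        D'.comul k (f x) = PiTensorProduct.map (fun _ => f) (D.comul k x) := by
      rw [D'.comul_eq_sum_reduced (by omega), D.comul_eq_sum_reduced (by omega)]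
      simp only [map_sum, map_ins, h1]
      refine Finset.sum_congr rfl fun j hj => ?_
      refine Finset.sum_congr rfl fun e _ => ?_
      congr 1
      match j, hj with
      | 0, _ => rw [reduced_zero_apply, reduced_zero_apply, map_zero]
      | 1, _ => simp [UnitalMagBialgebra.reduced_one, PiTensorProduct.map_tprod]
      | j + 2, hj =>
        exact h x hx _ (by omega) ((Nat.lt_succ_iff.mp (Finset.mem_range.mp hj)).trans hk)
    rw [← D.counit_smul_add_proj x]
    simp only [map_add, map_smul, h1, h' _ (D.proj x).2, D.comul_unit k h2 hk, D'.comul_unit k h2 hk,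
      PiTensorProduct.map_tprod]

/-- The restriction of a linear map that preserves the counits to their kernels. -/
def augMap {f : C →ₗ[K] C'} (hf : ∀ x, D'.counit (f x) = D.counit x) :
    LinearMap.ker D.counit →ₗ[K] LinearMap.ker D'.counit :=
  f.restrict fun x hx => LinearMap.mem_ker.mpr ((hf x).trans hx)

theorem IsHom.augReduced_apply {f : C →ₗ[K] C'} (hf : D.IsHom D' f) {k : ℕ} (hk : k ≤ m)
    (x : LinearMap.ker D.counit) :
    D'.augReduced k (augMap hf.map_counit x) =
      PiTensorProduct.map (fun _ => augMap hf.map_counit) (D.augReduced k x) := by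
  rw [← D'.map_proj_map_subtype (PiTensorProduct.map _ (D.augReduced k x)),
    map_map_apply (augMap hf.map_counit)]
  have : (LinearMap.ker D'.counit).subtype ∘ₗ augMap hf.map_counit =
      f ∘ₗ (LinearMap.ker D.counit).subtype := rfl
  rw [this, ← map_map_apply, D.map_subtype_augReduced hk,
    ← hf.reduced_apply hk]
  rfl

/-- The unital extension of a linear map between the kernels of the counits. -/
def unitalExt (D : UnitalMagCoalgebra K m C) (D' : UnitalMagCoalgebra K m C')
    (g : LinearMap.ker D.counit →ₗ[K] LinearMap.ker D'.counit) : C →ₗ[K] C' :=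
  D.counit.smulRight D'.one + (LinearMap.ker D'.counit).subtype ∘ₗ g ∘ₗ D.proj

theorem unitalExt_apply (g : LinearMap.ker D.counit →ₗ[K] LinearMap.ker D'.counit) (x : C) :
    unitalExt D D' g x = D.counit x • D'.one + g (D.proj x) := rfl

theorem unitalExt_coe (g : LinearMap.ker D.counit →ₗ[K] LinearMap.ker D'.counit)
    (x : LinearMap.ker D.counit) : unitalExt D D' g x = g x := by
  rw [unitalExt_apply, D.proj_coe, x.2, zero_smul, zero_add]

theorem isHom_unitalExt {g : LinearMap.ker D.counit →ₗ[K] LinearMap.ker D'.counit}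
    (hg : ∀ k, 2 ≤ k → k ≤ m → ∀ x,
      D'.augReduced k (g x) = PiTensorProduct.map (fun _ => g) (D.augReduced k x)) :
    D.IsHom D' (unitalExt D D' g) := by
  refine isHom_of_reduced ?_ (fun x => ?_) fun x hx k h2 hk => ?_
  · simp [unitalExt_apply, D.proj_one, D.counit_unit]
  · simp [unitalExt_apply, D'.counit_unit]
  · lift x to LinearMap.ker D.counit using hx
    rw [unitalExt_coe, ← D'.map_subtype_augReduced hk, hg k h2 hk, ← D.map_subtype_augReduced hk,
      map_map_apply, map_map_apply]
    congr 2
    funext _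
    ext y
    exact (unitalExt_coe g y).symm

end Hom

end UnitalMagCoalgebra

/-! ### The augmentation ideal of a bialgebra -/

namespace UnitalMagBialgebra

variable {K : Type v} [Field K] {m n : ℕ} {H : Type u} [AddCommGroup H] [Module K H]

/-- The compatibility relation is the shuffle expansion of a family with two terms: `μ_l(x)` in
arity `1`, giving the first sum, and `x_1 ⊗ ⋯ ⊗ x_l` in arity `l`, giving the second. -/
theorem reduced_mu (B : UnitalMagBialgebra K m n H) {k : ℕ} (hk : k ∈ Set.Icc 2 m) {l : ℕ}
    (hl : l ∈ Set.Icc 2 n) {x : Fin l → H} (hx : ∀ i, B.counit (x i) = 0) :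
    B.reduced k (B.mu l x) =
      if h : k = l then PiTensorProduct.tprod K fun i => x (i.cast h) else 0 := by
  have hl2 := hl.1
  rw [B.reduced_eq_of_comul_eq_sum (fun j =>
    if j = 1 then PiTensorProduct.tprod K fun _ => B.mu l x else
    if h : j = l then PiTensorProduct.tprod K fun i => x (i.cast h) else 0) ?_ ?_ ?_ hk.2]
  · exact if_neg (by have := hk.1; omega)
  · rw [if_neg (by omega), dif_neg (by omega)]
  · rw [if_pos rfl]
  · intro k h2 hkm
    rw [B.compat k h2 hkm l hl.1 hl.2 x hx,
      ← Finset.add_sum_erase _ _ (Finset.mem_range.mpr (show 1 < k + 1 by omega))]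
    congr 1
    · rw [← sum_oneEmb (f := fun w => PiTensorProduct.tprod K w)]
      simp [ins_tprod]
    · by_cases hlk : l ≤ k
      · rw [Finset.sum_eq_single l]
        · rw [if_neg (by omega), dif_pos rfl]
          simp [ins_tprod]
        · intro j hj hjl
          rw [if_neg (Finset.ne_of_mem_erase hj), dif_neg hjl]
          simp
        · exact fun h => absurd
            (Finset.mem_erase.mpr ⟨by omega, Finset.mem_range.mpr (by omega)⟩) h
      · have : IsEmpty (Fin l ↪o Fin k) := ⟨fun e => hlk (by
          simpa using Fintype.card_le_of_injective e e.injective)⟩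
        rw [Finset.univ_eq_empty (α := Fin l ↪o Fin k), Finset.sum_empty]
        refine (Finset.sum_eq_zero fun j hj => ?_).symm
        have hj' := Finset.mem_erase.mp hj
        have hj2 := Finset.mem_range.mp hj'.2
        rw [if_neg hj'.1, dif_neg (by omega)]
        simp

open scoped Classical in
/-- The operations of the kernel of the counit. -/
def augMu (B : UnitalMagBialgebra K m n H) (k : ℕ) :
    MultilinearMap K (fun _ : Fin k => LinearMap.ker B.counit) (LinearMap.ker B.counit) :=
  -- The condition `2 ≤ m` ensures that the co-operation `Δ_2` is available, from which the
  -- stability of the kernel of the counit under the operations is deduced; outside the relevant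
  -- range the operation is set to `0`.
  if h : 2 ≤ m ∧ k ∈ Set.Icc 2 n then
    ((B.mu k).compLinearMap fun _ => (LinearMap.ker B.counit).subtype).codRestrict _
      fun x => B.counit_mu h.1 k h.2.1 h.2.2 _ fun i => (x i).2
  else 0

theorem coe_augMu (B : UnitalMagBialgebra K m n H) (hm : 2 ≤ m) {k : ℕ} (hk : k ∈ Set.Icc 2 n)
    (x : Fin k → LinearMap.ker B.counit) :
    (B.augMu k x : H) = B.mu k fun i => (x i : H) := by
  rw [augMu, dif_pos ⟨hm, hk⟩]
  rfl

theorem augReduced_augMu_self (B : UnitalMagBialgebra K m n H) (hm : 2 ≤ m) {k : ℕ}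
    (hk : k ∈ Set.Icc 2 m) (hk' : k ∈ Set.Icc 2 n) (x : Fin k → LinearMap.ker B.counit) :
    B.augReduced k (B.augMu k x) = PiTensorProduct.tprod K x := by
  rw [UnitalMagCoalgebra.augReduced, LinearMap.comp_apply, LinearMap.comp_apply,
    Submodule.subtype_apply, B.coe_augMu hm hk', B.reduced_mu hk hk' fun i => (x i).2, dif_pos rfl,
    PiTensorProduct.map_tprod]
  exact congrArg _ (funext fun i => B.proj_coe (x i))

theorem augReduced_augMu_of_ne (B : UnitalMagBialgebra K m n H) (hm : 2 ≤ m) {k l : ℕ}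
    (hk : k ∈ Set.Icc 2 m) (hl : l ∈ Set.Icc 2 n) (h : l ≠ k)
    (x : Fin l → LinearMap.ker B.counit) : B.augReduced k (B.augMu l x) = 0 := by
  rw [UnitalMagCoalgebra.augReduced, LinearMap.comp_apply, LinearMap.comp_apply,
    Submodule.subtype_apply, B.coe_augMu hm hl, B.reduced_mu hk hl fun i => (x i).2,
    dif_neg h.symm, map_zero]

theorem mem_prim_iff (B : UnitalMagBialgebra K m n H) (x : LinearMap.ker B.counit) :
    (x : H) ∈ B.prim ↔ ∀ k ∈ Set.Icc 2 m, B.augReduced k x = 0 := by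
  simp only [UnitalMagCoalgebra.prim, Submodule.mem_iInf, LinearMap.mem_ker]
  refine forall₂_congr fun k hk => ⟨fun h => ?_, fun h => ?_⟩
  · rw [UnitalMagCoalgebra.augReduced, LinearMap.comp_apply, LinearMap.comp_apply,
      Submodule.subtype_apply, h, map_zero]
  · rw [← B.map_subtype_augReduced hk.2, h, map_zero]

/-- The inclusion of the primitive part in the kernel of the counit. -/
def primIncl (B : UnitalMagBialgebra K m n H) (hm : 2 ≤ m) :
    B.prim →ₗ[K] LinearMap.ker B.counit :=
  Submodule.inclusion fun _ hx => counit_eq_zero_of_mem_prim B.toUnitalMagCoalgebra hm hx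

theorem coe_primIncl (B : UnitalMagBialgebra K m n H) (hm : 2 ≤ m) (x : B.prim) :
    (B.primIncl hm x : H) = x := rfl

theorem augReduced_primIncl (B : UnitalMagBialgebra K m n H) (hm : 2 ≤ m) {k : ℕ}
    (hk : k ∈ Set.Icc 2 m) (x : B.prim) : B.augReduced k (B.primIncl hm x) = 0 :=
  (B.mem_prim_iff _).mp x.2 k hk

/-- The projection `Id - ∑_k μ_k δ_k` of the kernel of the counit on the primitive part. -/
def primProj (B : UnitalMagBialgebra K m n H) (hm : 2 ≤ m) (hmn : m ≤ n) :
    LinearMap.ker B.counit →ₗ[K] B.prim :=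
  ((LinearMap.ker B.counit).subtype ∘ₗ (LinearMap.id - ∑ k ∈ Finset.Icc 2 m,
    PiTensorProduct.lift (B.augMu k) ∘ₗ B.augReduced k)).codRestrict B.prim fun x => by
      rw [LinearMap.comp_apply, Submodule.subtype_apply, mem_prim_iff]
      intro k hk
      have hsub : Set.Icc 2 m ⊆ Set.Icc 2 n := Set.Icc_subset_Icc_right hmn
      -- In `δ_k(x - ∑_l μ_l δ_l x)` only the term `l = k` of the sum survives, and it cancels `δ_k
      -- x`.
      have h1 (l : ℕ) (hl : l ∈ Set.Icc 2 m) (h : l ≠ k) :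
          B.augReduced k ∘ₗ PiTensorProduct.lift (B.augMu l) = 0 := by
        ext1
        ext1 v
        simpa using B.augReduced_augMu_of_ne hm hk (hsub hl) h v
      have h2 : B.augReduced k ∘ₗ PiTensorProduct.lift (B.augMu k) = LinearMap.id := by
        ext1
        ext1 v
        simpa using B.augReduced_augMu_self hm hk (hsub hk) v
      rw [LinearMap.sub_apply, map_sub, LinearMap.sum_apply, map_sum, Finset.sum_eq_single k]
      · exact sub_eq_zero.mpr (LinearMap.congr_fun h2 _).symm
      · exact fun l hl h => LinearMap.congr_fun (h1 l (Finset.mem_Icc.mp hl) h) _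
      · exact fun h => absurd (Finset.mem_Icc.mpr hk) h

variable (B : UnitalMagBialgebra K m n H) (hm : 2 ≤ m) (hmn : m ≤ n)

theorem primIncl_primProj (x : LinearMap.ker B.counit) :
    B.primIncl hm (B.primProj hm hmn x) = x - ∑ k ∈ Finset.Icc 2 m,
      PiTensorProduct.lift (B.augMu k) (B.augReduced k x) := by
  refine Subtype.ext ?_
  rw [coe_primIncl, primProj, LinearMap.codRestrict_apply, LinearMap.comp_apply,
    LinearMap.sub_apply, LinearMap.sum_apply]
  rfl

theorem primIncl_injective : Function.Injective (B.primIncl hm) :=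
  Submodule.inclusion_injective _

theorem primProj_primIncl (x : B.prim) : B.primProj hm hmn (B.primIncl hm x) = x := by
  refine B.primIncl_injective hm ?_
  rw [primIncl_primProj, Finset.sum_eq_zero fun k hk => ?_, sub_zero]
  rw [B.augReduced_primIncl hm (Finset.mem_Icc.mp hk), map_zero]

theorem primProj_augMu {k : ℕ} (hk : k ∈ Set.Icc 2 m) (x : Fin k → LinearMap.ker B.counit) :
    B.primProj hm hmn (B.augMu k x) = 0 := by
  refine B.primIncl_injective hm ?_
  have hk' : k ∈ Set.Icc 2 n := Set.Icc_subset_Icc_right hmn hk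
  rw [primIncl_primProj, Finset.sum_eq_single k, B.augReduced_augMu_self hm hk hk',
    PiTensorProduct.lift.tprod, sub_self, map_zero]
  · intro l hl h
    rw [B.augReduced_augMu_of_ne hm (Finset.mem_Icc.mp hl) hk' h.symm, map_zero]
  · exact fun h => absurd (Finset.mem_Icc.mpr hk) h

/-- The tree sums are the coalgebra morphisms with prescribed primitive part. -/
theorem isTreeSum_augMu_iff {C : Type*} [AddCommGroup C] [Module K C]
    {δ : (k : ℕ) → C →ₗ[K] ⨂[K] _ : Fin k, C} {φ : C →ₗ[K] B.prim}
    {f : C →ₗ[K] LinearMap.ker B.counit} :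
    IsTreeSum B.augMu δ m (B.primIncl hm ∘ₗ φ) f ↔ B.primProj hm hmn ∘ₗ f = φ ∧
      ∀ k ∈ Set.Icc 2 m, ∀ x, B.augReduced k (f x) = PiTensorProduct.map (fun _ => f) (δ k x) := by
  have hsub : Set.Icc 2 m ⊆ Set.Icc 2 n := Set.Icc_subset_Icc_right hmn
  constructor
  · intro hf
    have h : ∀ k ∈ Set.Icc 2 m, ∀ x,
        B.augReduced k (f x) = PiTensorProduct.map (fun _ => f) (δ k x) := fun k hk x =>
      hf.comul_apply (fun k hk => B.augReduced_augMu_self hm hk (hsub hk))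
        (fun k hk l hl => B.augReduced_augMu_of_ne hm hk (hsub hl))
        (fun k hk x => B.augReduced_primIncl hm hk _) hk x
    -- Once `f` commutes with the `δ_k`, the sum subtracted from `f x` by the projection is
    -- precisely the sum in the fixed point equation, and `φ x` remains.
    refine ⟨LinearMap.ext fun x => B.primIncl_injective hm ?_, h⟩
    rw [LinearMap.comp_apply, primIncl_primProj, sub_eq_iff_eq_add, hf x]
    congr 1
    refine Finset.sum_congr rfl fun k hk => ?_
    rw [← h k (Finset.mem_Icc.mp hk), hf x]
  -- Conversely, `f x = π(f x) + ∑_k μ_k δ_k(f x)` by definition of the projection, and `δ_k(f x)`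
  -- may be replaced by `f^{⊗ k} δ_k(x)`.
  · rintro ⟨rfl, h⟩ x
    rw [LinearMap.comp_apply, LinearMap.comp_apply, primIncl_primProj,
      Finset.sum_congr rfl fun k hk => congrArg (PiTensorProduct.lift (B.augMu k))
        (h k (Finset.mem_Icc.mp hk) x), sub_add_cancel]

/-- A connected bialgebra is cofree over its primitive part. -/
theorem isCofreeAmongConnected (hm : 2 ≤ m) (hmn : m ≤ n) (hB : B.toUnitalMagCoalgebra.IsConnected) :
    B.toUnitalMagCoalgebra.IsCofreeAmongConnected := by
  refine ⟨hB, B.prim, inferInstance, inferInstance, B.primProj hm hmn ∘ₗ B.proj, ?_, ?_⟩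
  · rw [LinearMap.comp_apply, B.proj_one, map_zero]
  · intro C' _ _ D' hD' φ hφ
    have hδ := hD'.isConilpotent
    -- As `φ` vanishes on the unit, its restriction to the augmentation ideal carries all the
    -- information.
    let φ' : LinearMap.ker D'.counit →ₗ[K] B.prim := φ ∘ₗ (LinearMap.ker D'.counit).subtype
    obtain ⟨f, hf⟩ := exists_isTreeSum B.augMu hδ (B.primIncl hm ∘ₗ φ')
    obtain ⟨hf1, hf2⟩ := (B.isTreeSum_augMu_iff hm hmn).mp hf
    refine ⟨UnitalMagCoalgebra.unitalExt D' B.toUnitalMagCoalgebra f,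
      ⟨UnitalMagCoalgebra.isHom_unitalExt fun k h2 hk => hf2 k ⟨h2, hk⟩, ?_⟩, ?_⟩
    · ext1 x
      rw [← D'.counit_smul_add_proj x]
      simp only [map_add, map_smul, hφ, LinearMap.comp_apply, UnitalMagCoalgebra.unitalExt_coe,
        B.proj_coe, smul_zero, zero_add]
      rw [(UnitalMagCoalgebra.isHom_unitalExt fun k h2 hk => hf2 k ⟨h2, hk⟩).map_unit, B.proj_one,
        map_zero, smul_zero, zero_add]
      exact LinearMap.congr_fun hf1 _
    · rintro g ⟨hg, hg'⟩
      -- Any lift restricts to the augmentation ideals as a solution of the same fixed point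
      -- equation.
      have h : IsTreeSum B.augMu D'.augReduced m (B.primIncl hm ∘ₗ φ')
          (UnitalMagCoalgebra.augMap hg.map_counit) := by
        refine (B.isTreeSum_augMu_iff hm hmn).mpr ⟨?_, fun k hk x => hg.augReduced_apply hk.2 x⟩
        ext1 x
        have h1 := LinearMap.congr_fun hg' x
        have h2 : (g x : H) = (UnitalMagCoalgebra.augMap hg.map_counit x : H) := rfl
        rw [LinearMap.comp_apply, LinearMap.comp_apply, h2, B.proj_coe] at h1
        exact h1
      have h' := hf.unique hδ h
      ext1 x
      rw [← D'.counit_smul_add_proj x, map_add, map_smul, hg.map_unit, h',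
        UnitalMagCoalgebra.unitalExt_apply]
      simp only [map_add, map_smul, D'.counit_unit, D'.proj_one, D'.proj_coe, smul_zero, zero_add,
        LinearMap.mem_ker.mp (D'.proj x).2, smul_eq_mul, mul_one, add_zero]
      rfl

end UnitalMagBialgebra

/-! ### The enveloping bialgebra -/

section TreeEval

variable {K : Type v} [Field K] {S : Set ℕ} {V : Type u} [AddCommGroup V] [Module K V]
  {A : Type u} [AddCommGroup A] [Module K A]

theorem treeOp_graft (mu : (k : ℕ) → MultilinearMap K (fun _ : Fin k => A) A) {k : ℕ} (hk : k ∈ S)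
    (ts : Fin k → PTree S) (v : (PTree.node k hk ts).Leaves → A) :
    treeOp mu (.node k hk ts) v = mu k fun i => treeOp mu (ts i) fun l => v ⟨i, l⟩ := rfl

open scoped Classical in
/-- The evaluation of labelled trees in an algebra, given the values of the labels. -/
def treeEval (mu : (k : ℕ) → MultilinearMap K (fun _ : Fin k => A) A) (φ : V →ₗ[K] A) :
    Mag K S V →ₗ[K] A :=
  DirectSum.toModule K (PTree S) A fun t =>
    PiTensorProduct.lift ((treeOp mu t).compLinearMap fun _ => φ)

theorem treeEval_labelled (mu : (k : ℕ) → MultilinearMap K (fun _ : Fin k => A) A) (φ : V →ₗ[K] A) (t : PTree S)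
    (v : t.Leaves → V) :
    treeEval mu φ (labelled K S V t (PiTensorProduct.tprod K v)) = treeOp mu t fun l => φ (v l) := by
  rw [treeEval, labelled, DirectSum.toModule_lof, PiTensorProduct.lift.tprod]
  rfl

theorem treeEval_graft (mu : (k : ℕ) → MultilinearMap K (fun _ : Fin k => A) A) (φ : V →ₗ[K] A) {k : ℕ} (hk : k ∈ S)
    (x : Fin k → Mag K S V) :
    treeEval mu φ (graft K k hk x) = mu k fun i => treeEval mu φ (x i) := by
  have h : (treeEval (S := S) mu φ).compMultilinearMap (graft K (V := V) k hk) =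
      (mu k).compLinearMap fun _ => treeEval mu φ := by
    refine mag_multilinear_ext (V := V) K fun ts v => ?_
    simp only [LinearMap.compMultilinearMap_apply, MultilinearMap.compLinearMap_apply]
    rw [graft_labelled, treeConcat_tprod, treeEval_labelled]
    simp only [treeEval_labelled]
    rfl
  exact congrArg (fun F => F x) h

end TreeEval

/-! ### Generation of the enveloping algebra -/

namespace MagRootAlgebra

variable {K : Type v} [Field K] {T S : Set ℕ} {A : Type u} [AddCommGroup A] [Module K A]
  (R : MagRootAlgebra K T S A)

/-- The canonical map from an algebra to its enveloping bialgebra. -/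
def toEnv : A →ₗ[K] Mag K S A ⧸ R.ideal :=
  R.ideal.mkQ ∘ₗ labelled K S A .leaf ∘ₗ
    (PiTensorProduct.subsingletonEquiv (R := K) (s := fun _ : Unit => A) ()).symm.toLinearMap

theorem toEnv_apply (a : A) :
    R.toEnv a = R.ideal.mkQ (labelled K S A .leaf (PiTensorProduct.tprod K fun _ => a)) :=
  congrArg (fun w => R.ideal.mkQ (labelled K S A .leaf w))
    (PiTensorProduct.subsingletonEquiv_symm_apply' (R := K) (M := A) () a)

theorem quotMu_mkQ {k : ℕ} (hk : k ∈ S) (x : Fin k → Mag K S A) :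
    R.quotMu k (fun i => R.ideal.mkQ (x i)) = R.ideal.mkQ (graft K k hk x) := by
  rw [quotMu, dif_pos hk, quotOp_mkQ]

theorem mkQ_labelled_node {k : ℕ} (hk : k ∈ S) (ts : Fin k → PTree S)
    (v : (PTree.node k hk ts).Leaves → A) :
    R.ideal.mkQ (labelled K S A (.node k hk ts) (PiTensorProduct.tprod K v)) =
      R.quotMu k fun i => R.ideal.mkQ
        (labelled K S A (ts i) (PiTensorProduct.tprod K fun l => v ⟨i, l⟩)) := by
  rw [R.quotMu_mkQ hk, graft_labelled, treeConcat_tprod K hk ts fun i l => v ⟨i, l⟩]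
  rfl

theorem mkQ_labelled_of_rootNotIn {t : PTree S} (ht : t.RootNotIn T) (v : t.Leaves → A) :
    R.ideal.mkQ (labelled K S A t (PiTensorProduct.tprod K v)) = R.toEnv (R.op t ht v) := by
  rw [toEnv_apply, ← sub_eq_zero, ← map_sub, ← LinearMap.mem_ker, Submodule.ker_mkQ]
  exact R.relations_subset ⟨t, ht, v, rfl⟩

theorem quotComul_toEnv (k : ℕ) (a : A) : R.quotComul k (R.toEnv a) = 0 := by
  rw [quotComul]
  split_ifs with hk
  · rw [toEnv_apply, quotCoop_mkQ, ungraft_labelled]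
    exact map_zero _
  · rfl

/-- The enveloping bialgebra is generated by `A` under the operations of arities in `T`. -/
theorem eq_top_of_quotMu_mem (W : Submodule K (Mag K S A ⧸ R.ideal)) (h : ∀ a, R.toEnv a ∈ W)
    (hW : ∀ k ∈ T, k ∈ S → ∀ x, (∀ i, x i ∈ W) → R.quotMu k x ∈ W) : W = ⊤ := by
  have key (t : PTree S) (v : t.Leaves → A) :
      R.ideal.mkQ (labelled K S A t (PiTensorProduct.tprod K v)) ∈ W := by
    induction t with
    | leaf =>
      rw [R.mkQ_labelled_of_rootNotIn (t := .leaf) trivial]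
      exact h _
    | node k hk ts ih =>
      -- A tree whose root has its arity in `T` is an operation applied to smaller trees. Otherwise
      -- the relations identify the whole tree with an element of `A`, whatever its subtrees are.
      by_cases hkT : k ∈ T
      · rw [mkQ_labelled_node]
        exact hW k hkT hk _ fun i => ih i _
      · rw [R.mkQ_labelled_of_rootNotIn (t := .node k hk ts) hkT]
        exact h _
  classical
  -- Membership in `W` is rephrased as the vanishing of a linear map, which can be tested on trees
  -- labelled by pure tensors.
  have h' : W.mkQ ∘ₗ R.ideal.mkQ = 0 := by
    refine DirectSum.linearMap_ext K fun t => ?_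
    ext v
    have := key t v
    rw [← W.ker_mkQ] at this
    simpa [labelled] using this
  rw [eq_top_iff]
  rintro x -
  obtain ⟨y, rfl⟩ := R.ideal.mkQ_surjective x
  rw [← W.ker_mkQ]
  exact LinearMap.congr_fun h' y

theorem ideal_le (J : Submodule K (Mag K S A)) (h : R.relations ⊆ J)
    (h' : ∀ (k : ℕ) (hk : k ∈ S) (x : Fin k → Mag K S A) (i : Fin k),
      x i ∈ J → graft K k hk x ∈ J) : R.ideal ≤ J :=
  sInf_le ⟨h, h'⟩

end MagRootAlgebra

/-! ### Functoriality and special values of tree sums -/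

section TreeSum

variable {K : Type v} [Field K] {m : ℕ} {M A A' : Type*} [AddCommGroup M] [Module K M]
  [AddCommGroup A] [Module K A] [AddCommGroup A'] [Module K A']
  {mu : (k : ℕ) → MultilinearMap K (fun _ : Fin k => A) A}
  {mu' : (k : ℕ) → MultilinearMap K (fun _ : Fin k => A') A'}
  {δ : (k : ℕ) → M →ₗ[K] ⨂[K] _ : Fin k, M} {φ f : M →ₗ[K] A}

theorem IsTreeSum.comp (hf : IsTreeSum mu δ m φ f) (g : A →ₗ[K] A')
    (hg : ∀ k ∈ Set.Icc 2 m, ∀ x, g (mu k x) = mu' k fun i => g (x i)) :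
    IsTreeSum mu' δ m (g ∘ₗ φ) (g ∘ₗ f) := by
  intro x
  rw [LinearMap.comp_apply, LinearMap.comp_apply, hf x, map_add, map_sum]
  congr 1
  refine Finset.sum_congr rfl fun k hk => ?_
  rw [← map_map_apply]
  have : g ∘ₗ PiTensorProduct.lift (mu k) =
      PiTensorProduct.lift (mu' k) ∘ₗ PiTensorProduct.map fun _ => g := by
    ext v
    simpa using hg k (Finset.mem_Icc.mp hk) v
  exact LinearMap.congr_fun this _

theorem IsTreeSum.apply_of_eq_zero (hf : IsTreeSum mu δ m φ f) {x : M}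
    (hx : ∀ k ∈ Set.Icc 2 m, δ k x = 0) : f x = φ x := by
  rw [hf x, Finset.sum_eq_zero, add_zero]
  intro k hk
  rw [hx k (Finset.mem_Icc.mp hk), map_zero, map_zero]

/-- Meant for `x = μ_k(y_1, …, y_k)`: the other co-operations vanish there, so that a tree sum
respects the operations of arity at most `m`. -/
theorem IsTreeSum.apply_of_eq_tprod (hf : IsTreeSum mu δ m φ f) {x : M} (hφ : φ x = 0) {k : ℕ}
    (hk : k ∈ Set.Icc 2 m) {y : Fin k → M} (hx : δ k x = PiTensorProduct.tprod K y)
    (hx' : ∀ l ∈ Set.Icc 2 m, k ≠ l → δ l x = 0) : f x = mu k fun i => f (y i) := by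
  rw [hf x, hφ, zero_add, Finset.sum_eq_single k]
  · rw [hx, PiTensorProduct.map_tprod, PiTensorProduct.lift.tprod]
  · intro l hl h
    rw [hx' l (Finset.mem_Icc.mp hl) h.symm, map_zero, map_zero]
  · exact fun h => absurd (Finset.mem_Icc.mpr hk) h

end TreeSum

/-! ### Reduced co-operations and algebra morphisms after adjunction of a unit -/

namespace MagBialgebra

variable {K : Type v} [Field K] {m n : ℕ} {M : Type u} [AddCommGroup M] [Module K M]

/-- The co-operations of `K 1 ⊕ M` were defined by the shuffle expansion of those of `M`, and such
an expansion is unique. -/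
theorem adjoinUnit_reduced (N : MagBialgebra K (Set.Icc 2 m) (Set.Icc 2 n) M) {k : ℕ}
    (hk : k ∈ Set.Icc 2 m) (y : M) : N.adjoinUnit.reduced k ((0, y) : K × M) =
      PiTensorProduct.map (fun _ => LinearMap.inr K K M) (N.comul k y) := by
  rw [N.adjoinUnit.reduced_eq_of_comul_eq_sum
    (fun j => PiTensorProduct.map (fun _ => LinearMap.inr K K M) (N.unitComulAux j y)) ?_ ?_ ?_ hk.2]
  · obtain ⟨k, rfl⟩ : ∃ j, k = j + 2 := ⟨k - 2, by have := hk.1; omega⟩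
    rfl
  · exact map_zero _
  · have : N.unitComulAux 1 y = PiTensorProduct.tprod K fun _ => y := by simp [unitComulAux]
    rw [this, PiTensorProduct.map_tprod]
    rfl
  · intro k _ _
    refine (N.unitComul_apply k _).trans ?_
    rw [zero_smul, zero_add]
    rfl

/-- The unital extension of an algebra morphism to `K 1 ⊕ M`. -/
theorem map_unitMu {S T : Set ℕ} {H : Type*} [AddCommGroup H] [Module K H]
    (N : MagBialgebra K T S M) (B : UnitalMagAlgebra K n H) (f : K × M →ₗ[K] H)
    (h1 : f (1, 0) = B.one)
    (h : ∀ k, 2 ≤ k → k ≤ n → ∀ y : Fin k → M,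
      f (0, N.mu k y) = B.mu k fun i => f (0, y i)) {k : ℕ} (hk1 : 1 ≤ k) (hk : k ≤ n)
    (x : Fin k → K × M) : f (N.unitMu k x) = B.mu k fun i => f (x i) := by
  induction k, hk1 using Nat.le_induction with
  | base => rw [N.unitMu_one, B.mu_one]
  | succ k hk1 ih =>
    have key : f.compMultilinearMap (N.unitMu (k + 1)) =
        (B.mu (k + 1)).compLinearMap fun _ => f := by
      -- The space `K 1 ⊕ M` is spanned by the unit and by `M`; `Option M` indexes this spanning
      -- set, with `none` for the unit.
      refine MultilinearMap.ext_of_span_eq_top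
        (g := fun _ => fun o : Option M => o.elim ((1, 0) : K × M) fun y => (0, y)) (fun _ => ?_)
        fun v => ?_
      · rw [eq_top_iff]
        rintro ⟨c, y⟩ -
        have h0 : ((c, y) : K × M) = c • (1, 0) + (0, y) := by simp
        rw [h0]
        exact add_mem (Submodule.smul_mem _ _ (Submodule.subset_span ⟨none, rfl⟩))
          (Submodule.subset_span ⟨some y, rfl⟩)
      · simp only [LinearMap.compMultilinearMap_apply, MultilinearMap.compLinearMap_apply]
        -- A unit among the arguments lowers the arity on both sides, and the induction hypothesis
        -- applies; otherwise all arguments lie in `M`.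
        by_cases hv : ∃ i, v i = none
        · obtain ⟨i, hi⟩ := hv
          have h2 : (fun j => (v j).elim ((1, 0) : K × M) fun y => (0, y)) =
              Fin.insertNth (α := fun _ => K × M) i (1, 0)
                fun j => (v (i.succAbove j)).elim ((1, 0) : K × M) fun y => (0, y) := by
            rw [Fin.eq_insertNth_iff, hi]
            exact ⟨rfl, rfl⟩
          have h3 : (fun j => f ((v j).elim ((1, 0) : K × M) fun y => (0, y))) =
              Fin.insertNth (α := fun _ => H) i B.one
                fun j => f ((v (i.succAbove j)).elim ((1, 0) : K × M) fun y => (0, y)) := by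
            rw [Fin.eq_insertNth_iff, hi]
            exact ⟨h1, rfl⟩
          rw [h2, N.unitMu_unit, ih (by omega), h3, B.mu_unit k hk1 hk]
        · have hv' (i) : ∃ y, v i = some y := Option.ne_none_iff_exists'.mp fun h => hv ⟨i, h⟩
          choose y hy using hv'
          obtain rfl : v = fun i => some (y i) := funext hy
          simp only [Option.elim_some]
          rw [N.unitMu_inr (k + 1) (by omega), h (k + 1) (by omega) hk]
    exact congrArg (fun F => F x) key

end MagBialgebra

/-! ### Comparison with the enveloping bialgebra of the primitive part -/

namespace UnitalMagBialgebra

variable {K : Type v} [Field K] {m n : ℕ} {H : Type u} [AddCommGroup H] [Module K H]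
  (B : UnitalMagBialgebra K m n H) (hm : 2 ≤ m) (hmn : m ≤ n)

theorem coe_treeOp_augMu (hm : 2 ≤ m) (t : PTree (Set.Icc 2 n)) (v : t.Leaves → LinearMap.ker B.counit) :
    (treeOp B.augMu t v : H) = treeOp B.mu t fun l => (v l : H) := by
  induction t with
  | leaf => rfl
  | node k hk ts ih =>
    rw [treeOp_graft, treeOp_graft, B.coe_augMu hm hk]
    exact congrArg (B.mu k) (funext fun i => ih i _)

/-- The canonical map from the enveloping bialgebra of the primitive part to the kernel of the
counit. -/
def envEval : (Mag K (Set.Icc 2 n) B.prim ⧸ B.primAlgebra.ideal) →ₗ[K] LinearMap.ker B.counit :=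
  B.primAlgebra.ideal.liftQ (treeEval B.augMu (B.primIncl hm)) <| by
    refine B.primAlgebra.ideal_le _ ?_ ?_
    · rintro z ⟨t, ht, a, rfl⟩
      rw [SetLike.mem_coe, LinearMap.mem_ker, map_sub, treeEval_labelled, treeEval_labelled,
        sub_eq_zero]
      -- A tree acts on the primitive part as the composite of the `μ_k` along it, so the evaluation
      -- of both sides of a relation is the same.
      exact Subtype.ext (B.coe_treeOp_augMu hm t _)
    · intro k hk x i hi
      rw [LinearMap.mem_ker, treeEval_graft]
      exact (B.augMu k).map_coord_zero i hi

theorem envEval_mkQ (x : Mag K (Set.Icc 2 n) B.prim) :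
    B.envEval hm (B.primAlgebra.ideal.mkQ x) = treeEval B.augMu (B.primIncl hm) x := rfl

theorem envEval_toEnv (a : B.prim) : B.envEval hm (B.primAlgebra.toEnv a) = B.primIncl hm a := by
  rw [MagRootAlgebra.toEnv_apply, envEval_mkQ, treeEval_labelled]
  rfl

theorem envEval_quotMu {k : ℕ} (hk : k ∈ Set.Icc 2 n)
    (x : Fin k → Mag K (Set.Icc 2 n) B.prim ⧸ B.primAlgebra.ideal) :
    B.envEval hm (B.primAlgebra.quotMu k x) = B.augMu k fun i => B.envEval hm (x i) := by
  obtain ⟨y, rfl⟩ : ∃ y : Fin k → Mag K (Set.Icc 2 n) B.prim,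
      x = fun i => B.primAlgebra.ideal.mkQ (y i) :=
    ⟨fun i => Quotient.out (x i), funext fun i => (Quotient.out_eq (x i)).symm⟩
  rw [B.primAlgebra.quotMu_mkQ hk, envEval_mkQ, treeEval_graft]
  rfl

/-- The inverse is the tree sum with values in the quotient algebra that starts from the projection
onto the primitive part. It decomposes an element repeatedly by co-operations, projects the factors
onto primitive elements, and records the result as labelled trees. -/
theorem exists_inverse_envEval (hmn : m ≤ n) (hB : B.toUnitalMagCoalgebra.IsConnected) :
    ∃ g : LinearMap.ker B.counit →ₗ[K] Mag K (Set.Icc 2 n) B.prim ⧸ B.primAlgebra.ideal,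
      (∀ x, B.envEval hm (g x) = x) ∧ (∀ u, g (B.envEval hm u) = u) ∧
      ∀ k ∈ Set.Icc 2 m, ∀ x, B.primAlgebra.quotComul k (g x) =
        PiTensorProduct.map (fun _ => g) (B.augReduced k x) := by
  have hsub : Set.Icc 2 m ⊆ Set.Icc 2 n := Set.Icc_subset_Icc_right hmn
  have hδ := hB.isConilpotent
  obtain ⟨g, hg⟩ := exists_isTreeSum B.primAlgebra.quotMu hδ
    (B.primAlgebra.toEnv ∘ₗ B.primProj hm hmn)
  have h1 : B.envEval hm ∘ₗ g = LinearMap.id := by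
    have h := hg.comp (mu' := B.augMu) (B.envEval hm) fun k hk => B.envEval_quotMu hm (hsub hk)
    have he : B.envEval hm ∘ₗ B.primAlgebra.toEnv ∘ₗ B.primProj hm hmn =
        B.primIncl hm ∘ₗ B.primProj hm hmn :=
      LinearMap.ext fun x => B.envEval_toEnv hm _
    rw [he] at h
    -- The identity is a coalgebra morphism whose primitive part is the projection, hence it solves
    -- the equation satisfied by the composite.
    refine h.unique hδ ((B.isTreeSum_augMu_iff hm hmn).mpr ⟨rfl, fun k hk x => ?_⟩)
    rw [PiTensorProduct.map_id]
    rfl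
  refine ⟨g, LinearMap.congr_fun h1, fun u => ?_, fun k hk x => ?_⟩
  · suffices h : LinearMap.ker (g ∘ₗ B.envEval hm - LinearMap.id) = ⊤ by
      have := LinearMap.congr_fun (LinearMap.ker_eq_top.mp h) u
      exact sub_eq_zero.mp this
    -- The set where the other composite is the identity contains `A`, since on primitive elements
    -- `g` reduces to its leading term. It is stable under the operations of arity at most `m`,
    -- since the leading term vanishes on their values and a single co-operation survives.
    refine B.primAlgebra.eq_top_of_quotMu_mem _ (fun a => ?_) fun k hk hk' x hx => ?_
    · refine LinearMap.mem_ker.mpr (sub_eq_zero.mpr ?_)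
      rw [LinearMap.comp_apply, envEval_toEnv,
        hg.apply_of_eq_zero fun k hk => B.augReduced_primIncl hm hk a, LinearMap.comp_apply,
        primProj_primIncl]
      rfl
    · have hx' (i) : g (B.envEval hm (x i)) = x i := sub_eq_zero.mp (LinearMap.mem_ker.mp (hx i))
      refine LinearMap.mem_ker.mpr (sub_eq_zero.mpr ?_)
      rw [LinearMap.comp_apply, B.envEval_quotMu hm hk',
        hg.apply_of_eq_tprod (by rw [LinearMap.comp_apply, B.primProj_augMu hm hmn hk, map_zero]) hk
          (B.augReduced_augMu_self hm hk hk' _)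
          fun l hl h => B.augReduced_augMu_of_ne hm hl hk' h _]
      simp only [hx']
      rfl
  · exact hg.comul_apply
      (fun k hk => B.primAlgebra.reducedEnv.comul_mu_self k hk (hsub hk))
      (fun k hk l hl h => B.primAlgebra.reducedEnv.comul_mu_of_ne k hk l (hsub hl) h)
      (fun k _ x => B.primAlgebra.quotComul_toEnv k _) hk x

/-- A connected bialgebra is the enveloping bialgebra of its primitive part. -/
theorem isIsomorphic_env (hm : 2 ≤ m) (hmn : m ≤ n) (hB : B.toUnitalMagCoalgebra.IsConnected) :
    B.IsIsomorphic B.primAlgebra.env := by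
  obtain ⟨g, hg1, hg2, hg3⟩ := B.exists_inverse_envEval hm hmn hB
  have hsum : ∀ p : K × (Mag K (Set.Icc 2 n) B.prim ⧸ B.primAlgebra.ideal),
      B.counit (p.1 • B.one + (B.envEval hm p.2 : H)) = p.1 := fun p => by
    rw [map_add, map_smul, B.counit_unit, LinearMap.mem_ker.mp (B.envEval hm p.2).2]
    simp
  -- The isomorphism separates the component along the unit and applies `g` to the rest; its inverse
  -- is `(c, u) ↦ c 1 + e(u)`, with `e` the evaluation of trees.
  let f : H ≃ₗ[K] K × (Mag K (Set.Icc 2 n) B.prim ⧸ B.primAlgebra.ideal) :=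
    LinearEquiv.ofLinearMap (B.counit.prod (g ∘ₗ B.proj))
      ((LinearMap.fst K K (Mag K (Set.Icc 2 n) B.prim ⧸ B.primAlgebra.ideal)).smulRight B.one +
        (LinearMap.ker B.counit).subtype ∘ₗ B.envEval hm ∘ₗ LinearMap.snd K K _)
      (LinearMap.ext fun p => Prod.ext (hsum p) (by
        change g (B.proj (p.1 • B.one + (B.envEval hm p.2 : H))) = p.2
        rw [map_add, map_smul, B.proj_one, B.proj_coe, smul_zero, zero_add, hg2]))
      (LinearMap.ext fun x => by
        change B.counit x • B.one + (B.envEval hm (g (B.proj x)) : H) = x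
        rw [hg1, B.counit_smul_add_proj])
  have hf (x : H) : f x = (B.counit x, g (B.proj x)) := rfl
  have hfs (p) : f.symm p = p.1 • B.one + (B.envEval hm p.2 : H) := rfl
  refine ⟨f, UnitalMagCoalgebra.isHom_of_reduced ?_ (fun _ => rfl) fun x hx k h2 hk => ?_, ?_⟩
  · change f B.one = (1, 0)
    rw [hf, B.counit_unit, B.proj_one, map_zero]
  · lift x to LinearMap.ker B.counit using hx
    have hx' (y : LinearMap.ker B.counit) : f y = (0, g y) := by
      rw [hf, B.proj_coe, LinearMap.mem_ker.mp y.2]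
    rw [← B.map_subtype_augReduced hk, map_map_apply, LinearEquiv.coe_coe, hx']
    refine (MagBialgebra.adjoinUnit_reduced _ ⟨h2, hk⟩ _).trans ?_
    refine (congrArg _ (hg3 k ⟨h2, hk⟩ x)).trans ?_
    rw [map_map_apply]
    congr 2
    funext _
    exact LinearMap.ext fun y => (hx' y).symm
  · intro k h2 hk x
    -- Compatibility with the operations is checked on the inverse map, which is built from the
    -- evaluation of trees, an algebra morphism.
    have h := B.primAlgebra.reducedEnv.map_unitMu B.toUnitalMagAlgebra f.symm.toLinearMap
      (by simp [hfs]) (fun l h2 hl y => ?_) (by omega) hk (fun i => f (x i))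
    · rw [LinearEquiv.coe_coe, LinearEquiv.symm_apply_eq] at h
      simp only [LinearEquiv.symm_apply_apply] at h
      exact h.symm
    · simp only [LinearEquiv.coe_coe, hfs, zero_smul, zero_add]
      refine (congrArg Subtype.val (B.envEval_quotMu hm ⟨h2, hl⟩ y)).trans ?_
      exact B.coe_augMu hm ⟨h2, hl⟩ _

/-- At the root, `δ_l μ_k` is zero unless `l = k`, in which case it returns the arguments; a tree
with more than `∑ r_i` leaves then has an `i`-th subtree with more than `r_i` leaves. The summand
`1` excludes the trivial tree, which acts as the identity. -/
theorem reducedTree_mu_eq_zero (hmn : m ≤ n) {k : ℕ} (hk : k ∈ Set.Icc 2 m) {x : Fin k → H}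
    (hx : ∀ i, B.counit (x i) = 0) {r : Fin k → ℕ}
    (hr : ∀ i, ∀ t : PTree (Set.Icc 2 m), r i < t.numLeaves → B.reducedTree t (x i) = 0)
    {t : PTree (Set.Icc 2 m)} (ht : 1 + ∑ i, r i < t.numLeaves) :
    B.reducedTree t (B.mu k x) = 0 := by
  cases t with
  | leaf => simp [PTree.numLeaves] at ht
  | node l hl ts =>
    rw [UnitalMagCoalgebra.reducedTree, LinearMap.comp_apply,
      B.reduced_mu hl (Set.Icc_subset_Icc_right hmn hk) hx]
    split_ifs with h
    · subst h
      rw [PiTensorProduct.lift.tprod, MultilinearMap.compLinearMap_apply]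
      obtain ⟨i, hi⟩ : ∃ i, r i < (ts i).numLeaves := by
        by_contra! hle
        have : (PTree.node l hl ts).numLeaves ≤ ∑ i, r i := Finset.sum_le_sum fun i _ => hle i
        omega
      exact MultilinearMap.map_coord_zero _ i (hr i _ hi)
    · exact map_zero _

theorem exists_reducedTree_prim_eq_zero {x : H} (hx : x ∈ B.prim) :
    ∃ r, ∀ t : PTree (Set.Icc 2 m), r < t.numLeaves → B.reducedTree t x = 0 := by
  refine ⟨1, fun t ht => ?_⟩
  cases t with
  | leaf => simp [PTree.numLeaves] at ht
  | node l hl ts =>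
    simp only [UnitalMagCoalgebra.prim, Submodule.mem_iInf, LinearMap.mem_ker] at hx
    rw [UnitalMagCoalgebra.reducedTree, LinearMap.comp_apply, hx l hl, map_zero]

/-- A bialgebra isomorphic to the enveloping bialgebra of its primitive part is connected. -/
theorem isConnected_of_isIsomorphic_env (hmn : m ≤ n) (h : B.IsIsomorphic B.primAlgebra.env) :
    B.toUnitalMagCoalgebra.IsConnected := by
  obtain ⟨f, hf, hfmu⟩ := h
  have hcounit (u) : B.counit (f.symm (0, u)) = 0 := by
    have := hf.map_counit (f.symm (0, u))
    rw [LinearEquiv.coe_coe, LinearEquiv.apply_symm_apply] at this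
    exact this.symm
  -- Those elements of the quotient whose preimage in `H` is annihilated by all large composites;
  -- the generation property will show that they are all the elements.
  let W : Submodule K (Mag K (Set.Icc 2 n) B.prim ⧸ B.primAlgebra.ideal) :=
    { carrier := {u | ∃ r, ∀ t : PTree (Set.Icc 2 m), r < t.numLeaves →
        B.reducedTree t (f.symm (0, u)) = 0}
      zero_mem' := ⟨0, fun t _ => by
        have : ((0, 0) : K × (Mag K (Set.Icc 2 n) B.prim ⧸ B.primAlgebra.ideal)) = 0 := rfl
        rw [this, map_zero, map_zero]⟩
      add_mem' := by
        rintro u u' ⟨r, hr⟩ ⟨r', hr'⟩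
        refine ⟨max r r', fun t ht => ?_⟩
        have : ((0, u + u') : K × (Mag K (Set.Icc 2 n) B.prim ⧸ B.primAlgebra.ideal)) =
          (0, u) + (0, u') := by simp
        rw [this, map_add, map_add, hr t (by omega), hr' t (by omega), add_zero]
      smul_mem' := by
        rintro c u ⟨r, hr⟩
        refine ⟨r, fun t ht => ?_⟩
        have : ((0, c • u) : K × (Mag K (Set.Icc 2 n) B.prim ⧸ B.primAlgebra.ideal)) =
          c • (0, u) := by simp
        rw [this, map_smul, map_smul, hr t ht, smul_zero] }
  have hW : W = ⊤ := by
    refine B.primAlgebra.eq_top_of_quotMu_mem W (fun a => ?_) fun k hk hk' u hu => ?_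
    -- The elements of `A` have vanishing reduced co-operations in the enveloping bialgebra, and the
    -- inverse of a coalgebra isomorphism carries this over to `H`. The isomorphism need not be the
    -- canonical one.
    · refine B.exists_reducedTree_prim_eq_zero ?_
      simp only [UnitalMagCoalgebra.prim, Submodule.mem_iInf, LinearMap.mem_ker]
      intro k hk
      have h := hf.reduced_apply hk.2 (f.symm (0, B.primAlgebra.toEnv a))
      rw [LinearEquiv.coe_coe, LinearEquiv.apply_symm_apply] at h
      have h' := (MagBialgebra.adjoinUnit_reduced B.primAlgebra.reducedEnv hk
        (B.primAlgebra.toEnv a)).symm.trans h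
      rw [show B.primAlgebra.reducedEnv.comul k (B.primAlgebra.toEnv a) = 0 from
        B.primAlgebra.quotComul_toEnv k a, map_zero] at h'
      have h2 := congrArg (PiTensorProduct.map fun _ => f.symm.toLinearMap) h'.symm
      have hid : f.symm.toLinearMap ∘ₗ f.toLinearMap = LinearMap.id :=
        LinearMap.ext f.symm_apply_apply
      rw [map_map_apply, map_zero, hid, PiTensorProduct.map_id] at h2
      exact h2
    · choose r hr using hu
      refine ⟨1 + ∑ i, r i, fun t ht => ?_⟩
      have h : f.symm (0, B.primAlgebra.quotMu k u) = B.mu k fun i => f.symm (0, u i) := by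
        rw [LinearEquiv.symm_apply_eq, hfmu k hk'.1 hk'.2]
        simp only [LinearEquiv.apply_symm_apply]
        exact (B.primAlgebra.reducedEnv.unitMu_inr k hk'.1 u).symm
      rw [h]
      exact B.reducedTree_mu_eq_zero hmn hk (fun i => hcounit (u i)) hr ht
  refine B.isConnected_of_reducedTree fun x hx => ?_
  have h2 : f x = (0, (f x).2) := Prod.ext ((hf.map_counit x).trans hx) rfl
  obtain ⟨r, hr⟩ : (f x).2 ∈ W := hW ▸ Submodule.mem_top
  rw [← h2, LinearEquiv.symm_apply_apply] at hr
  exact ⟨r, hr⟩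

end UnitalMagBialgebra

end
end Magmatic

theorem mainTheorem3 {K : Type v} [Field K] [CharZero K] (m n : ℕ) (hm : 2 ≤ m) (hmn : m ≤ n)
    {H : Type u} [AddCommGroup H] [Module K H] (B : Magmatic.UnitalMagBialgebra K m n H) :
    List.TFAE [
      B.toUnitalMagCoalgebra.IsConnected,
      B.IsIsomorphic B.primAlgebra.env,
      B.toUnitalMagCoalgebra.IsCofreeAmongConnected] := by
  tfae_have 1 → 2 := B.isIsomorphic_env hm hmn
  tfae_have 2 → 1 := B.isConnected_of_isIsomorphic_env hmn
  tfae_have 1 → 3 := B.isCofreeAmongConnected hm hmn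
  -- Connectedness is the first clause of cofreeness.
  tfae_have 3 → 1 := fun h => h.1
  tfae_finish
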